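/- Fix $1<p<\infty$ and $1/p+1/p'=1$. A rooted tree $T$ is a locally finite tree with a root vertex $o$ that has exactly one edge, the root edge $\omega$; $E(T)$ is its edge set. To superimpose trees, all rooted trees are regarded as subtrees, with the common root edge $\omega=\emptyset$, of the universal tree whose edges are the finite words over $\mathbb{N}$, the edges following $x$ being the words $xa$, $a\in\mathbb{N}$. The boundary $\partial T$ is the set of half-infinite geodesics starting at the root together with the leaves of $T$; for $\zeta\in\partial T$, $P(\zeta)$ is the set of edges of the geodesic from $o$ to $\zeta$. For $\alpha\in E(T)$ put $\partial T_\alpha=\{\zeta\in\partial T:\alpha\in P(\zeta)\}$; these sets form a basis of the topology of $\partial T$. For $f:E(T)\to[0,\infty)$ put $If(\zeta)=\sum_{\alpha\in P(\zeta)}f(\alpha)$, and for $A\subseteq\partial T$ put $\Omega_A=\{f\in\ell^p(E(T)): f\ge 0,\ If\ge 1\text{ on }A\}$ and $c_p(A)=\inf_{f\in\Omega_A}\|f\|_{\ell^p}^p$. The equilibrium measure of $\partial T$ is the finite positive Borel measure $\mu$ on $\partial T$ with $\mu(\partial T)=c_p(\partial T)$ for which the function $M_p(\alpha)=\mu(\partial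 T_\alpha)^{p'-1}$ lies in the $\ell^p$-closure of $\Omega_{\partial T}$ and satisfies $\|M_p\|_{\ell^p}^p=c_p(\partial T)$. A point $\zeta\in\partial T$ is $p$-irregular if $IM_p(\zeta)<1$, and $\partial T$ is regular if it has no $p$-irregular points. The biggest common subtree $\langle T,R\rangle$ has edge set $E(T)\cap E(R)$. **Theorem (Approximation of capacity via regular boundaries).** Let $T$ be a rooted tree with $c_p(\partial T)>0$. Then there is a rooted tree $R$ with regular boundary such that $$c_p(\partial R)=c_p(\partial T).$$ Moreover, for every $\varepsilon>0$ such an $R$ can be chosen so that $$c_p(\partial\langle T,R\rangle)\ge c_p(\partial T)-\varepsilon .$$ This holds even if edges that are leaves of $\langle T,R\rangle$ only because the edges after them were erased are not counted as boundary points, that is, with $\partial\langle T,R\rangle$ replaced by its subset $\partial T\cap\partial R$ of the points of $\partial\langle T,R\rangle$ that are boundary points of both $T$ and $R$. -/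

import Mathlib

open scoped ENNReal NNReal
open MeasureTheory

noncomputable section

/-- A locally finite rooted tree having one root edge `ω`, given by its edges inside the universal
tree of all finite words over `ℕ`: the empty word is `ω`, and the edges that follow the edge `x`
(that depart from its end vertex) are the words `x ++ [a]` of the tree.  The vertices other than
the root vertex `o` are the end vertices of the edges. -/
structure LocallyFiniteTree where
  carrier : Descriptive.tree ℕ
  root_mem : [] ∈ carrier
  finite_children : ∀ x ∈ carrier, {a : ℕ | x ++ [a] ∈ carrier}.Finite

namespace LocallyFiniteTree

/-- The edge set `E(T)`. -/
def Edge (T : LocallyFiniteTree) : Type := {x : List ℕ // x ∈ T.carrier}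

/-- A leaf is an edge with no edge after it. -/
def IsLeaf (T : LocallyFiniteTree) (x : List ℕ) : Prop :=
  x ∈ T.carrier ∧ ∀ a : ℕ, x ++ [a] ∉ T.carrier

/-- `P` is the set of edges of a half infinite geodesic that starts with the root edge. -/
def IsRay (T : LocallyFiniteTree) (P : Set (List ℕ)) : Prop :=
  ∃ s : ℕ → List ℕ, s 0 = [] ∧ (∀ n, ∃ a : ℕ, s (n + 1) = s n ++ [a]) ∧
    (∀ n, s n ∈ T.carrier) ∧ P = Set.range s

/-- `P` is the set of edges of the geodesic from the root to a leaf (the leaf included). -/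
def IsLeafPath (T : LocallyFiniteTree) (P : Set (List ℕ)) : Prop :=
  ∃ x, T.IsLeaf x ∧ P = {y | y <+: x}

/-- A boundary point is a half infinite geodesic from the root or a leaf; it is represented by its
predecessor set, the set of the edges on the geodesic from the root to it. -/
def IsBoundaryPoint (T : LocallyFiniteTree) (P : Set (List ℕ)) : Prop :=
  T.IsRay P ∨ T.IsLeafPath P

/-- The boundary `∂T`. -/
def Boundary (T : LocallyFiniteTree) : Type := {P : Set (List ℕ) // T.IsBoundaryPoint P}

/-- The boundary `∂T_α` of the tent rooted in the edge `α`, as a subset of `∂T`. -/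
def tentBoundary (T : LocallyFiniteTree) (α : T.Edge) : Set T.Boundary := {ζ | α.1 ∈ ζ.1}

/-- The topology of `∂T` is generated by the boundaries of tents. -/
instance (T : LocallyFiniteTree) : TopologicalSpace T.Boundary :=
  TopologicalSpace.generateFrom (Set.range T.tentBoundary)

instance (T : LocallyFiniteTree) : MeasurableSpace T.Boundary := borel T.Boundary

instance (T : LocallyFiniteTree) : BorelSpace T.Boundary := ⟨rfl⟩

/-- The potential `I f (ζ) = ∑_{α ∈ P(ζ)} f(α)`. -/
def potential (T : LocallyFiniteTree) (f : T.Edge → ℝ≥0) (ζ : T.Boundary) : ℝ≥0∞ :=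
  ∑' α : {α : T.Edge // α.1 ∈ ζ.1}, (f α.1 : ℝ≥0∞)

/-- `‖f‖_p^p`, the norm being that of `ℓ^p(E(T))`. -/
def normPow (T : LocallyFiniteTree) (p : ℝ) (f : T.Edge → ℝ≥0) : ℝ≥0∞ :=
  ∑' α : T.Edge, (f α : ℝ≥0∞) ^ p

/-- `Ω_E`: the nonnegative functions in `ℓ^p` with `I f ≥ 1` on `E`. -/
def testFunctions (T : LocallyFiniteTree) (p : ℝ) (E : Set T.Boundary) : Set (T.Edge → ℝ≥0) :=
  {f | T.normPow p f < ∞ ∧ ∀ ζ ∈ E, 1 ≤ T.potential f ζ}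

/-- The `p`-capacity `c_p(E)` of `E ⊆ ∂T`. -/
def capacity (T : LocallyFiniteTree) (p : ℝ) (E : Set T.Boundary) : ℝ≥0∞ :=
  ⨅ f ∈ T.testFunctions p E, T.normPow p f

/-- The capacity `c_p(∂T)` of the whole boundary. -/
def boundaryCapacity (T : LocallyFiniteTree) (p : ℝ) : ℝ≥0∞ := T.capacity p Set.univ

/-- `f` is admissible for `E`: it lies in the `ℓ^p`-closure of `Ω_E`. -/
def IsAdmissible (T : LocallyFiniteTree) (p : ℝ) (E : Set T.Boundary) (f : T.Edge → ℝ≥0) : Prop :=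
  ∀ δ : ℝ≥0∞, 0 < δ → ∃ g ∈ T.testFunctions p E, ∑' α : T.Edge, edist (f α) (g α) ^ p < δ

/-- `f` is the `p`-equilibrium function of `E`: admissible, with `‖f‖_p^p = c_p(E)`. -/
def IsEquilibriumFunction (T : LocallyFiniteTree) (p : ℝ) (E : Set T.Boundary)
    (f : T.Edge → ℝ≥0) : Prop :=
  T.IsAdmissible p E f ∧ T.normPow p f = T.capacity p E

/-- For a finite measure `μ` on `∂T` with co-potential `M(α) = μ(∂T_α)`, this is the edge function
`M_p = M ^ (p' - 1)`, where `1/p + 1/p' = 1`. -/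
def copotentialPow (T : LocallyFiniteTree) (p : ℝ) (μ : Measure T.Boundary) (α : T.Edge) : ℝ≥0 :=
  (μ (T.tentBoundary α)).toNNReal ^ (p.conjExponent - 1)

/-- `μ` is the `p`-equilibrium measure of `E`: a finite positive Borel measure carried by the
closure of `E`, of total mass `c_p(E)`, such that `M_p` is the `p`-equilibrium function of `E`. -/
structure IsEquilibriumMeasure (T : LocallyFiniteTree) (p : ℝ) (E : Set T.Boundary)
    (μ : Measure T.Boundary) : Prop where
  finite : IsFiniteMeasure μ
  carried : μ (closure E)ᶜ = 0
  equilibrium : T.IsEquilibriumFunction p E (T.copotentialPow p μ)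
  mass : μ (closure E) = T.capacity p E

/-- The irregular points `{ζ ∈ E : I M_p (ζ) < 1}`, for `μ` the equilibrium measure of `E`. -/
def irregularPoints (T : LocallyFiniteTree) (p : ℝ) (E : Set T.Boundary) (μ : Measure T.Boundary) :
    Set T.Boundary :=
  {ζ | ζ ∈ E ∧ T.potential (T.copotentialPow p μ) ζ < 1}

/-- `∂T` is regular: its equilibrium measure has no irregular points. -/
def HasRegularBoundary (T : LocallyFiniteTree) (p : ℝ) : Prop :=
  ∃ μ : Measure T.Boundary, T.IsEquilibriumMeasure p Set.univ μ ∧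
    T.irregularPoints p Set.univ μ = ∅

/-- The biggest common subtree `⟨T, R⟩`: an edge is kept when it and all the edges before it belong
to both trees. -/
def commonSubtree (T R : LocallyFiniteTree) : LocallyFiniteTree where
  carrier := T.carrier ⊓ R.carrier
  root_mem := ⟨T.root_mem, R.root_mem⟩
  finite_children := fun x hx => (T.finite_children x hx.1).subset fun _ ha => ha.1

/-- The boundary points of `⟨T, R⟩` that are boundary points of both `T` and `R`.  This is
`∂⟨T, R⟩` without the edges that have become leaves only because the edges after them were
erased. -/
def commonBoundary (T R : LocallyFiniteTree) : Set (T.commonSubtree R).Boundary :=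
  {ζ | T.IsBoundaryPoint ζ.1 ∧ R.IsBoundaryPoint ζ.1}

end LocallyFiniteTree

end

/-! Let d(x) be the capacity of the tent rooted at x. An edge in series with the tents after it
gives a recursion for d. Any solution in [0,1] with value 1 at the leaves (`IsWeight`) determines a
flow M, hence a measure μ of mass d(ω), and f = M^(p'-1). The potential of f telescopes to one minus
a product (`pathSum_eqFun`), so it never exceeds 1, and ∫ If dμ = ‖f‖^p. Young's inequality gives
d(ω) ≤ c_p(∂T), with equality and regularity as soon as If ≥ 1 everywhere (`hasRegularBoundary`).

The limit of the capacities of truncated trees is a weight that attains c_p(∂T)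
(`boundaryCapacity_eq`). Its f has energy equal to the mass, so If = 1 μ-almost everywhere
(`ae_one_le_tsum_eqFun`), and the irregular points lie in an open set U of small measure. Tents
inside U are replaced by caterpillars of the same capacity, whose rays are all regular
(`tendsto_survival_of_cut`). The recursion sees only capacities, so the total is kept, and rays that
avoid the replaced tents keep their potential. Boundary points outside U are common to both trees,
and testing μ on them alone loses at most p·μ(U) of capacity (`le_of_forall_mem`). -/

namespace LocallyFiniteTree

/-! ### Boundary points as maximal chains of edges -/

theorem mem_of_concat_mem (T : LocallyFiniteTree) {x : List ℕ} {a : ℕ}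
    (h : x ++ [a] ∈ T.carrier) : x ∈ T.carrier :=
  Descriptive.Tree.mem_of_append h

/-- A set of edges of `T` that is a chain for the prefix order, closed under prefixes and maximal
with these properties. -/
structure IsMaximalPath (T : LocallyFiniteTree) (P : Set (List ℕ)) : Prop where
  nil_mem : [] ∈ P
  subset : ∀ x ∈ P, x ∈ T.carrier
  prefix_mem : ∀ x y, y ∈ P → x <+: y → x ∈ P
  chain : ∀ x ∈ P, ∀ y ∈ P, x <+: y ∨ y <+: x
  exists_concat : ∀ x ∈ P, ¬ T.IsLeaf x → ∃ a : ℕ, x ++ [a] ∈ P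

section Ray

variable {s : ℕ → List ℕ} (h0 : s 0 = []) (hs : ∀ n, ∃ a : ℕ, s (n + 1) = s n ++ [a])
include h0 hs

theorem length_of_ray (n : ℕ) : (s n).length = n := by
  induction n with
  | zero => simp [h0]
  | succ n ih => obtain ⟨a, ha⟩ := hs n; simp [ha, ih]

omit h0 in
theorem prefix_of_ray {m n : ℕ} (hmn : m ≤ n) : s m <+: s n := by
  induction n, hmn using Nat.le_induction with
  | base => exact List.prefix_rfl
  | succ n _ ih => obtain ⟨a, ha⟩ := hs n; rw [ha]; exact ih.trans (List.prefix_append _ _)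

theorem mem_range_of_prefix_ray {x : List ℕ} {n : ℕ} (hx : x <+: s n) : x = s x.length := by
  have h1 : x.length ≤ n := by simpa [length_of_ray h0 hs] using hx.length_le
  have h2 := prefix_of_ray hs h1
  have h3 : (s x.length).length = x.length := length_of_ray h0 hs _
  exact (List.prefix_of_prefix_length_le hx h2 h3.ge).eq_of_length h3.symm

end Ray

variable {T : LocallyFiniteTree} {P : Set (List ℕ)}

theorem IsBoundaryPoint.isMaximalPath (h : T.IsBoundaryPoint P) : T.IsMaximalPath P := by
  rcases h with ⟨s, h0, hs, hT, rfl⟩ | ⟨x, hx, rfl⟩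
  · refine ⟨⟨0, h0⟩, ?_, ?_, ?_, ?_⟩
    · rintro _ ⟨n, rfl⟩; exact hT n
    · rintro x _ ⟨n, rfl⟩ hx; exact ⟨_, (mem_range_of_prefix_ray h0 hs hx).symm⟩
    · rintro _ ⟨m, rfl⟩ _ ⟨n, rfl⟩
      exact (le_total m n).imp (prefix_of_ray hs) (prefix_of_ray hs)
    · rintro _ ⟨n, rfl⟩ -
      obtain ⟨a, ha⟩ := hs n
      exact ⟨a, n + 1, ha⟩
  · refine ⟨List.nil_prefix, fun y hy => Descriptive.Tree.mem_of_prefix hy hx.1,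
      fun y z hz hy => hy.trans hz, fun y hy z hz => List.prefix_or_prefix_of_prefix hy hz, ?_⟩
    rintro y ⟨z, rfl⟩ hl
    cases z with
    | nil => simp at hx; exact absurd hx hl
    | cons a z => exact ⟨a, z, by simp⟩

theorem IsMaximalPath.eq_of_isLeaf (h : T.IsMaximalPath P) {x : List ℕ} (hx : x ∈ P)
    (hl : T.IsLeaf x) : P = {y | y <+: x} := by
  refine Set.ext fun y => ⟨fun hy => ?_, fun hy => h.prefix_mem _ _ hx hy⟩
  rcases h.chain y hy x hx with h1 | ⟨z, rfl⟩
  · exact h1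
  · cases z with
    | nil => simp
    | cons a z =>
      refine absurd ?_ (hl.2 a)
      exact h.subset _ (h.prefix_mem _ _ hy ⟨z, by simp⟩)

theorem IsMaximalPath.isRay (h : T.IsMaximalPath P) (hl : ∀ x ∈ P, ¬ T.IsLeaf x) : T.IsRay P := by
  choose! e he using fun x hx => h.exists_concat x hx (hl x hx)
  let s : ℕ → List ℕ := fun n => Nat.rec [] (fun _ x => x ++ [e x]) n
  have h0 : s 0 = [] := rfl
  have hs : ∀ n, s (n + 1) = s n ++ [e (s n)] := fun n => rfl
  have hs' : ∀ n, ∃ a : ℕ, s (n + 1) = s n ++ [a] := fun n => ⟨_, hs n⟩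
  have hP : ∀ n, s n ∈ P := by
    intro n
    induction n with
    | zero => exact h.nil_mem
    | succ n ih => exact he _ ih
  refine ⟨s, h0, hs', fun n => h.subset _ (hP n), Set.ext fun x => ⟨fun hx => ?_, ?_⟩⟩
  · have hlen := length_of_ray h0 hs' x.length
    refine ⟨x.length, ?_⟩
    rcases h.chain x hx _ (hP x.length) with h1 | h1
    · exact (h1.eq_of_length hlen.symm).symm
    · exact h1.eq_of_length hlen
  · rintro ⟨n, rfl⟩; exact hP n

/-- Treats rays and leaves alike, and makes it easy to carry a boundary point from one tree to
another. -/
theorem isBoundaryPoint_iff : T.IsBoundaryPoint P ↔ T.IsMaximalPath P := by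
  refine ⟨IsBoundaryPoint.isMaximalPath, fun h => ?_⟩
  by_cases hl : ∃ x ∈ P, T.IsLeaf x
  · obtain ⟨x, hx, hl⟩ := hl
    exact Or.inr ⟨x, hl, h.eq_of_isLeaf hx hl⟩
  · push Not at hl
    exact Or.inl (h.isRay hl)

theorem Boundary.isMaximalPath (ζ : T.Boundary) : T.IsMaximalPath ζ.1 :=
  ζ.2.isMaximalPath

/-- Every boundary point has an edge at level `n`, or ends at a leaf before. -/
theorem IsMaximalPath.exists_length_eq_or_isLeaf (h : T.IsMaximalPath P) (n : ℕ) :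
    ∃ x ∈ P, x.length = n ∨ x.length ≤ n ∧ T.IsLeaf x := by
  induction n with
  | zero => exact ⟨[], h.nil_mem, Or.inl rfl⟩
  | succ n ih =>
    obtain ⟨x, hx, hxn⟩ := ih
    by_cases hl : T.IsLeaf x
    · exact ⟨x, hx, Or.inr ⟨by omega, hl⟩⟩
    · obtain ⟨a, ha⟩ := h.exists_concat x hx hl
      exact ⟨_, ha, Or.inl (by simp; tauto)⟩

/-! ### Topology of the boundary -/

variable (T) in
/-- The boundary points that pass through the word `x`. -/
def tent (x : List ℕ) : Set T.Boundary := {ζ | x ∈ ζ.1}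

theorem tent_of_notMem {x : List ℕ} (hx : x ∉ T.carrier) : T.tent x = ∅ :=
  Set.eq_empty_of_forall_notMem fun ζ hζ => hx (ζ.isMaximalPath.subset x hζ)

theorem tent_nil : T.tent [] = Set.univ :=
  Set.eq_univ_of_forall fun ζ => ζ.isMaximalPath.nil_mem

theorem isTopologicalBasis_tentBoundary :
    TopologicalSpace.IsTopologicalBasis (Set.range T.tentBoundary) where
  exists_subset_inter := by
    rintro _ ⟨x, rfl⟩ _ ⟨y, rfl⟩ ζ ⟨hx, hy⟩
    rcases ζ.isMaximalPath.chain _ hx _ hy with h | h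
    · exact ⟨_, ⟨y, rfl⟩, hy, fun ξ hξ => ⟨ξ.isMaximalPath.prefix_mem _ _ hξ h, hξ⟩⟩
    · exact ⟨_, ⟨x, rfl⟩, hx, fun ξ hξ => ⟨hξ, ξ.isMaximalPath.prefix_mem _ _ hξ h⟩⟩
  sUnion_eq := Set.eq_univ_of_forall fun ζ =>
    ⟨_, ⟨⟨[], T.root_mem⟩, rfl⟩, ζ.isMaximalPath.nil_mem⟩
  eq_generateFrom := rfl

theorem isOpen_tent (x : List ℕ) : IsOpen (T.tent x) := by
  by_cases hx : x ∈ T.carrier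
  · exact isTopologicalBasis_tentBoundary.isOpen ⟨⟨x, hx⟩, rfl⟩
  · rw [tent_of_notMem hx]; exact isOpen_empty

theorem exists_tent_subset {U : Set T.Boundary} (hU : IsOpen U) {ζ : T.Boundary} (hζ : ζ ∈ U) :
    ∃ x ∈ ζ.1, T.tent x ⊆ U := by
  obtain ⟨_, ⟨x, rfl⟩, hx, hxU⟩ := isTopologicalBasis_tentBoundary.exists_subset_of_mem_open hζ hU
  exact ⟨x.1, hx, hxU⟩

/-- The edge of ζ at the level of `x`, or the leaf where ζ ends earlier, already decides whether ζ
passes through `x`. -/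
theorem isClosed_tent (x : List ℕ) : IsClosed (T.tent x) := by
  rw [← isOpen_compl_iff, isOpen_iff_forall_mem_open]
  intro ζ hζ
  obtain ⟨y, hy, hyx⟩ := ζ.isMaximalPath.exists_length_eq_or_isLeaf x.length
  refine ⟨T.tent y, fun ξ hξ hx => hζ ?_, isOpen_tent y, hy⟩
  rcases hyx with hyx | ⟨-, hl⟩
  · rcases ξ.isMaximalPath.chain _ hξ _ hx with h | h
    · rwa [h.eq_of_length hyx] at hy
    · rwa [← h.eq_of_length hyx.symm] at hy
  · have hx' : x ∈ ξ.1 := hx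
    rw [ξ.isMaximalPath.eq_of_isLeaf hξ hl] at hx'
    exact ζ.isMaximalPath.prefix_mem _ _ hy hx'

instance : Countable T.Edge := inferInstanceAs (Countable {x : List ℕ // x ∈ T.carrier})

instance : SecondCountableTopology T.Boundary :=
  isTopologicalBasis_tentBoundary.secondCountableTopology (Set.countable_range _)

/-- The clopen base gives regularity. With second countability the boundary is pseudometrizable, so
finite Borel measures on it are outer regular. -/
instance : RegularSpace T.Boundary := by
  refine RegularSpace.of_exists_mem_nhds_isClosed_subset fun ζ s hs => ?_
  obtain ⟨U, hUs, hU, hζ⟩ := mem_nhds_iff.1 hs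
  obtain ⟨x, hx, hxU⟩ := exists_tent_subset hU hζ
  exact ⟨T.tent x, (isOpen_tent x).mem_nhds hx, isClosed_tent x, hxU.trans hUs⟩

theorem measurableSet_tent (x : List ℕ) : MeasurableSet (T.tent x) :=
  (isOpen_tent x).measurableSet

theorem borel_boundary_eq_generateFrom :
    borel T.Boundary = MeasurableSpace.generateFrom (Set.range T.tentBoundary) :=
  borel_eq_generateFrom_of_subbasis rfl

theorem exists_isOpen_superset_measure_lt (μ : Measure T.Boundary) [IsFiniteMeasure μ]
    {A : Set T.Boundary} {r : ℝ≥0∞} (h : μ A < r) : ∃ U, A ⊆ U ∧ IsOpen U ∧ μ U < r := by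
  let _ := TopologicalSpace.pseudoMetrizableSpacePseudoMetric T.Boundary
  obtain ⟨U, h1, h2, h3⟩ := A.exists_isOpen_lt_of_lt r h
  exact ⟨U, h1, h2, h3⟩

end LocallyFiniteTree

namespace LocallyFiniteTree

variable {T : LocallyFiniteTree} {P : Set (List ℕ)}

/-! ### Potentials and norms of functions of words -/

/-- The sum of `g` over the prefixes of `x`. -/
noncomputable def pathSum {M : Type*} [AddCommMonoid M] (g : List ℕ → M) (x : List ℕ) : M :=
  ∑ k ∈ Finset.range (x.length + 1), g (x.take k)

theorem pathSum_concat {M : Type*} [AddCommMonoid M] (g : List ℕ → M) (x : List ℕ) (a : ℕ) :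
    pathSum g (x ++ [a]) = pathSum g x + g (x ++ [a]) := by
  rw [pathSum, List.length_append, List.length_singleton, Finset.sum_range_succ, pathSum]
  congr 1
  · refine Finset.sum_congr rfl fun k hk => ?_
    rw [List.take_append_of_le_length (by simp at hk; omega)]
  · rw [List.take_of_length_le (by simp)]

theorem injOn_take (x : List ℕ) :
    Set.InjOn (fun k => x.take k) (Finset.range (x.length + 1) : Finset ℕ) := by
  intro k hk l hl h
  have := congrArg List.length h
  simp at hk hl this
  omega

theorem IsMaximalPath.pathSum_le_tsum (h : T.IsMaximalPath P) (g : List ℕ → ℝ≥0∞) {x : List ℕ}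
    (hx : x ∈ P) : pathSum g x ≤ ∑' y : P, g y := by
  let f : Fin (x.length + 1) → P := fun k => ⟨x.take k, h.prefix_mem _ _ hx (List.take_prefix _ _)⟩
  have hf : Function.Injective f := fun k l hkl =>
    Fin.ext (injOn_take x (by simpa using k.is_le) (by simpa using l.is_le) (congrArg Subtype.val hkl))
  calc pathSum g x = ∑' k, g (f k) := by
        rw [tsum_fintype, pathSum, ← Fin.sum_univ_eq_sum_range (fun k => g (x.take k))]
    _ ≤ _ := ENNReal.tsum_comp_le_tsum_of_injective hf fun y : P => g y

/-- A finite part of a chain consists of prefixes of its longest member, so its sum is at most one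
path sum. -/
theorem IsMaximalPath.tsum_le (h : T.IsMaximalPath P) (g : List ℕ → ℝ≥0∞) {B : ℝ≥0∞}
    (hB : ∀ x ∈ P, pathSum g x ≤ B) : ∑' y : P, g y ≤ B := by
  rw [ENNReal.tsum_eq_iSup_sum]
  refine iSup_le fun s => ?_
  rcases s.eq_empty_or_nonempty with rfl | hs
  · simp
  obtain ⟨x, -, hx⟩ := s.exists_max_image (fun y => y.1.length) hs
  refine le_trans ?_ (hB x.1 x.2)
  have hmap : ∑ y ∈ s, g y = ∑ y ∈ s.map ⟨Subtype.val, Subtype.val_injective⟩, g y :=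
    (Finset.sum_map s ⟨Subtype.val, Subtype.val_injective⟩ g).symm
  rw [pathSum, ← Finset.sum_image (f := g) (injOn_take x.1), hmap]
  refine Finset.sum_le_sum_of_subset fun y hy => ?_
  obtain ⟨z, hz, rfl⟩ := Finset.mem_map.1 hy
  have hzx : z.1 <+: x.1 := by
    rcases h.chain _ z.2 _ x.2 with h1 | h1
    · exact h1
    · rw [h1.eq_of_length_le (hx z hz)]
  exact Finset.mem_image.2 ⟨z.1.length, by simpa [Nat.lt_succ_iff] using hzx.length_le,
    (List.prefix_iff_eq_take.1 hzx).symm⟩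

theorem potential_eq_tsum (g : List ℕ → ℝ≥0) (ζ : T.Boundary) :
    T.potential (fun α => g α.1) ζ = ∑' x : ζ.1, (g x : ℝ≥0∞) := by
  let e : {α : T.Edge // α.1 ∈ ζ.1} ≃ ζ.1 :=
    { toFun := fun α => ⟨α.1.1, α.2⟩
      invFun := fun x => ⟨⟨x.1, ζ.isMaximalPath.subset _ x.2⟩, x.2⟩
      left_inv := fun _ => rfl
      right_inv := fun _ => rfl }
  exact e.tsum_eq fun x : ζ.1 => (g x : ℝ≥0∞)

theorem normPow_eq_tsum {p : ℝ} (hp : 0 < p) (g : List ℕ → ℝ≥0) (hg : ∀ x ∉ T.carrier, g x = 0) :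
    T.normPow p (fun α => g α.1) = ∑' x : List ℕ, (g x : ℝ≥0∞) ^ p := by
  refine tsum_subtype_eq_of_support_subset (f := fun x => (g x : ℝ≥0∞) ^ p)
    (s := {x | x ∈ T.carrier}) fun x hx => ?_
  by_contra h
  exact hx (by simp [hg x h, hp])

open Classical in
/-- The extension by zero of a function of the edges of `T`. -/
noncomputable def extend (T : LocallyFiniteTree) (f : T.Edge → ℝ≥0) (x : List ℕ) : ℝ≥0 :=
  if h : x ∈ T.carrier then f ⟨x, h⟩ else 0

theorem extend_of_notMem (f : T.Edge → ℝ≥0) {x : List ℕ} (hx : x ∉ T.carrier) :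
    T.extend f x = 0 := dif_neg hx

theorem extend_coe (f : T.Edge → ℝ≥0) : (fun α : T.Edge => T.extend f α.1) = f :=
  funext fun α => dif_pos α.2

theorem potential_eq_tsum_extend (f : T.Edge → ℝ≥0) (ζ : T.Boundary) :
    T.potential f ζ = ∑' x : ζ.1, (T.extend f x : ℝ≥0∞) := by
  rw [← potential_eq_tsum, extend_coe]

theorem normPow_eq_tsum_extend {p : ℝ} (hp : 0 < p) (f : T.Edge → ℝ≥0) :
    T.normPow p f = ∑' x : List ℕ, (T.extend f x : ℝ≥0∞) ^ p := by
  rw [← normPow_eq_tsum hp _ fun x hx => extend_of_notMem f hx, extend_coe]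

/-! ### The measure of a flow -/

/-- The left endpoint of the interval coding the word `x`. -/
noncomputable def leftEnd (M : List ℕ → ℝ) (x : List ℕ) : ℝ :=
  List.reverseRecOn x 0 fun y a r => r + ∑ b ∈ Finset.range a, M (y ++ [b])

theorem leftEnd_nil (M : List ℕ → ℝ) : leftEnd M [] = 0 := by simp [leftEnd]

theorem leftEnd_concat (M : List ℕ → ℝ) (x : List ℕ) (a : ℕ) :
    leftEnd M (x ++ [a]) = leftEnd M x + ∑ b ∈ Finset.range a, M (x ++ [b]) := by
  simp [leftEnd]

/-- The interval coding the word `x`: the intervals of the words following `x` split it from left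
to right. -/
noncomputable def codeInterval (M : List ℕ → ℝ) (x : List ℕ) : Set ℝ :=
  Set.Ico (leftEnd M x) (leftEnd M x + M x)

variable (T) in
/-- A flow on `T`: a nonnegative function of the edges which at every edge that is not a leaf
is the sum of its values at the edges that follow. -/
structure IsFlow (M : List ℕ → ℝ) : Prop where
  nonneg : ∀ x, 0 ≤ M x
  eq_zero : ∀ x ∉ T.carrier, M x = 0
  hasSum : ∀ x ∈ T.carrier, ¬ T.IsLeaf x → HasSum (fun a => M (x ++ [a])) (M x)

namespace IsFlow

variable {M : List ℕ → ℝ} (hM : T.IsFlow M)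
include hM

theorem mem_carrier {x : List ℕ} {t : ℝ} (ht : t ∈ codeInterval M x) : x ∈ T.carrier := by
  by_contra h
  simp [codeInterval, hM.eq_zero x h] at ht

theorem codeInterval_concat_subset (x : List ℕ) (a : ℕ) :
    codeInterval M (x ++ [a]) ⊆ codeInterval M x := by
  intro t ht
  have hxa := hM.mem_carrier ht
  have hs := hM.hasSum x (T.mem_of_concat_mem hxa) fun hl => hl.2 a hxa
  have h1 := sum_le_hasSum (Finset.range (a + 1)) (fun b _ => hM.nonneg _) hs
  have h2 : 0 ≤ ∑ b ∈ Finset.range a, M (x ++ [b]) := Finset.sum_nonneg fun b _ => hM.nonneg _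
  rw [Finset.sum_range_succ] at h1
  rw [codeInterval, leftEnd_concat] at ht
  exact ⟨by linarith [ht.1], by linarith [ht.2]⟩

theorem codeInterval_subset_of_prefix {x y : List ℕ} (h : x <+: y) :
    codeInterval M y ⊆ codeInterval M x := by
  obtain ⟨z, rfl⟩ := h
  induction z using List.reverseRecOn with
  | nil => simp
  | append_singleton z a ih =>
    rw [← List.append_assoc]
    exact (hM.codeInterval_concat_subset _ a).trans ih

theorem eq_of_mem_codeInterval_concat {x : List ℕ} {a b : ℕ} {t : ℝ}
    (ha : t ∈ codeInterval M (x ++ [a])) (hb : t ∈ codeInterval M (x ++ [b])) : a = b := by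
  wlog h : a < b generalizing a b
  · rcases (not_lt.1 h).eq_or_lt with h | h
    · exact h.symm
    · exact (this hb ha h).symm
  rw [codeInterval, leftEnd_concat] at ha hb
  have : ∑ c ∈ Finset.range (a + 1), M (x ++ [c]) ≤ ∑ c ∈ Finset.range b, M (x ++ [c]) :=
    Finset.sum_le_sum_of_subset_of_nonneg (Finset.range_mono h) fun c _ _ => hM.nonneg _
  rw [Finset.sum_range_succ] at this
  linarith [ha.2, hb.1]

theorem exists_mem_codeInterval_concat {x : List ℕ} {t : ℝ} (ht : t ∈ codeInterval M x)
    (hl : ¬ T.IsLeaf x) : ∃ a, t ∈ codeInterval M (x ++ [a]) := by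
  classical
  have hs := (hM.hasSum x (hM.mem_carrier ht) hl).tendsto_sum_nat
  have hex : ∃ n, t - leftEnd M x < ∑ b ∈ Finset.range n, M (x ++ [b]) :=
    (hs.eventually (lt_mem_nhds (by linarith [ht.2]))).exists
  -- The least such `n` is positive, and the letter just below it is the one whose interval contains
  -- `t`.
  obtain ⟨n, hn, hmin⟩ : ∃ n, t - leftEnd M x < ∑ b ∈ Finset.range n, M (x ++ [b]) ∧
      ∀ k < n, ¬ t - leftEnd M x < ∑ b ∈ Finset.range k, M (x ++ [b]) :=
    ⟨Nat.find hex, Nat.find_spec hex, fun k hk => Nat.find_min hex hk⟩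
  cases n with
  | zero => simp at hn; linarith [ht.1]
  | succ n =>
    have := hmin n (Nat.lt_succ_self n)
    rw [Finset.sum_range_succ] at hn
    exact ⟨n, by rw [codeInterval, leftEnd_concat]; constructor <;> linarith⟩

theorem prefix_of_mem_codeInterval {x y : List ℕ} {t : ℝ} (hx : t ∈ codeInterval M x)
    (hy : t ∈ codeInterval M y) (h : x.length ≤ y.length) : x <+: y := by
  induction x using List.reverseRecOn with
  | nil => exact List.nil_prefix
  | append_singleton x a ih =>
    simp only [List.length_append, List.length_singleton] at h
    obtain ⟨z, rfl⟩ := ih (hM.codeInterval_concat_subset _ _ hx) (by omega)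
    cases z with
    | nil => simp at h
    | cons b z =>
      have hb : t ∈ codeInterval M (x ++ [b]) :=
        hM.codeInterval_subset_of_prefix ⟨z, by simp⟩ hy
      rw [hM.eq_of_mem_codeInterval_concat hx hb]
      exact ⟨z, by simp⟩

theorem isMaximalPath_code {t : ℝ} (ht : t ∈ Set.Ico 0 (M [])) :
    T.IsMaximalPath {x | t ∈ codeInterval M x} where
  nil_mem := by simpa [codeInterval, leftEnd_nil] using ht
  subset x hx := hM.mem_carrier hx
  prefix_mem x y hy h := hM.codeInterval_subset_of_prefix h hy
  chain x hx y hy := (le_total x.length y.length).imp (hM.prefix_of_mem_codeInterval hx hy)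
    (hM.prefix_of_mem_codeInterval hy hx)
  exists_concat x hx hl := hM.exists_mem_codeInterval_concat hx hl

/-- The code intervals containing a number in [0, M(ω)) form a boundary point. Pushing Lebesgue
measure forward along this map gives each tent the length of its interval. -/
theorem exists_measure : ∃ μ : Measure T.Boundary, ∀ x, μ (T.tent x) = ENNReal.ofReal (M x) := by
  let Φ : Set.Ico 0 (M []) → T.Boundary := fun t =>
    ⟨{x | t.1 ∈ codeInterval M x}, isBoundaryPoint_iff.2 (hM.isMaximalPath_code t.2)⟩
  have hΦ : Measurable Φ := by
    change @Measurable _ _ _ (borel T.Boundary) Φ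
    rw [borel_boundary_eq_generateFrom]
    refine measurable_generateFrom ?_
    rintro _ ⟨x, rfl⟩
    exact measurable_subtype_coe (measurableSet_Ico (a := leftEnd M x.1) (b := leftEnd M x.1 + M x.1))
  refine ⟨(volume.comap Subtype.val).map Φ, fun x => ?_⟩
  have hpre : Φ ⁻¹' T.tent x = Subtype.val ⁻¹' codeInterval M x := rfl
  have hsub : codeInterval M x ⊆ Set.Ico 0 (M []) := by
    simpa [codeInterval, leftEnd_nil] using
      hM.codeInterval_subset_of_prefix (List.nil_prefix (l := x))
  rw [Measure.map_apply hΦ (measurableSet_tent x), hpre,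
    comap_subtype_coe_apply measurableSet_Ico, Subtype.image_preimage_coe,
    Set.inter_eq_right.2 hsub, codeInterval, Real.volume_Ico, add_sub_cancel_left]

end IsFlow

/-! ### Integration of potentials -/

theorem tsum_eq_tsum_indicator_tent (g : List ℕ → ℝ≥0∞) (ζ : T.Boundary) :
    ∑' x : ζ.1, g x = ∑' x, (T.tent x).indicator (fun _ => g x) ζ := by
  rw [tsum_subtype]
  rfl

theorem lintegral_tsum_eq {μ : Measure T.Boundary} {m : List ℕ → ℝ≥0∞}
    (hμ : ∀ x, μ (T.tent x) = m x) (g : List ℕ → ℝ≥0∞) :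
    ∫⁻ ζ, ∑' x : ζ.1, g x ∂μ = ∑' x, g x * m x := by
  simp_rw [tsum_eq_tsum_indicator_tent]
  rw [lintegral_tsum fun x => (measurable_const.indicator (measurableSet_tent x)).aemeasurable]
  simp_rw [lintegral_indicator_const (measurableSet_tent _), hμ]

theorem measurable_tsum (g : List ℕ → ℝ≥0∞) :
    Measurable fun ζ : T.Boundary => ∑' x : ζ.1, g x := by
  simp_rw [tsum_eq_tsum_indicator_tent]
  exact Measurable.tsum fun x => measurable_const.indicator (measurableSet_tent x)

end LocallyFiniteTree

namespace LocallyFiniteTree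

variable {T : LocallyFiniteTree} {P : Set (List ℕ)} {p : ℝ} {d : List ℕ → ℝ}

/-! ### Weights -/

/-- The part of the potential that is left after the edge `x`, relative to that before `x`. -/
noncomputable def drop (p : ℝ) (d : List ℕ → ℝ) (x : List ℕ) : ℝ := 1 - d x ^ (p - 1)⁻¹

/-- The part of the potential that is left before the edge `x`. -/
noncomputable def survival (p : ℝ) (d : List ℕ → ℝ) (x : List ℕ) : ℝ :=
  ∏ k ∈ Finset.range x.length, drop p d (x.take k)

/-- The flow, a candidate for the co-potential of the equilibrium measure. -/
noncomputable def weightFlow (p : ℝ) (d : List ℕ → ℝ) (x : List ℕ) : ℝ :=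
  survival p d x ^ (p - 1) * d x

/-- The candidate for the equilibrium function. -/
noncomputable def eqFun (p : ℝ) (d : List ℕ → ℝ) (x : List ℕ) : ℝ :=
  survival p d x * d x ^ (p - 1)⁻¹

variable (T) in
/-- A solution with values in `[0, 1]` of the recursion satisfied by the capacities of the
boundaries of the tents of `T`. -/
structure IsWeight (p : ℝ) (d : List ℕ → ℝ) : Prop where
  nonneg : ∀ x, 0 ≤ d x
  le_one : ∀ x, d x ≤ 1
  eq_zero : ∀ x ∉ T.carrier, d x = 0
  eq_one : ∀ x, T.IsLeaf x → d x = 1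
  hasSum : ∀ x ∈ T.carrier, ¬ T.IsLeaf x →
    HasSum (fun a => drop p d x ^ (p - 1) * d (x ++ [a])) (d x)

theorem survival_nil : survival p d [] = 1 := by simp [survival]

theorem survival_concat (x : List ℕ) (a : ℕ) :
    survival p d (x ++ [a]) = survival p d x * drop p d x := by
  rw [survival, List.length_append, List.length_singleton, Finset.prod_range_succ, survival]
  congr 1
  · refine Finset.prod_congr rfl fun k hk => ?_
    rw [List.take_append_of_le_length (by simp at hk; omega)]
  · rw [List.take_left']
    rfl

/-- Telescoping: the value at an edge is the survival before it minus the survival after it. -/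
theorem pathSum_eqFun (x : List ℕ) :
    pathSum (eqFun p d) x = 1 - survival p d x * drop p d x := by
  induction x using List.reverseRecOn with
  | nil => simp [pathSum, eqFun, survival_nil, drop]
  | append_singleton x a ih =>
    rw [pathSum_concat, ih, survival_concat, eqFun, survival_concat, drop.eq_def p d (x ++ [a])]
    ring

namespace IsWeight

variable (hd : T.IsWeight p d)
include hd

theorem drop_nonneg (hp : 1 < p) (x : List ℕ) : 0 ≤ drop p d x :=
  sub_nonneg.2 (Real.rpow_le_one (hd.nonneg x) (hd.le_one x) (by simp; linarith))

theorem drop_le_one (x : List ℕ) : drop p d x ≤ 1 :=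
  sub_le_self _ (Real.rpow_nonneg (hd.nonneg x) _)

theorem survival_nonneg (hp : 1 < p) (x : List ℕ) : 0 ≤ survival p d x :=
  Finset.prod_nonneg fun _ _ => hd.drop_nonneg hp _

theorem weightFlow_nonneg (hp : 1 < p) (x : List ℕ) : 0 ≤ weightFlow p d x :=
  mul_nonneg (Real.rpow_nonneg (hd.survival_nonneg hp x) _) (hd.nonneg x)

theorem eqFun_nonneg (hp : 1 < p) (x : List ℕ) : 0 ≤ eqFun p d x :=
  mul_nonneg (hd.survival_nonneg hp x) (Real.rpow_nonneg (hd.nonneg x) _)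

theorem weightFlow_rpow (hp : 1 < p) (x : List ℕ) :
    weightFlow p d x ^ (p - 1)⁻¹ = eqFun p d x := by
  rw [weightFlow, Real.mul_rpow (Real.rpow_nonneg (hd.survival_nonneg hp x) _) (hd.nonneg x),
    ← Real.rpow_mul (hd.survival_nonneg hp x), mul_inv_cancel₀ (by linarith), Real.rpow_one, eqFun]

theorem eqFun_rpow (hp : 1 < p) (x : List ℕ) :
    eqFun p d x ^ p = weightFlow p d x ^ p.conjExponent := by
  rw [← hd.weightFlow_rpow hp, ← Real.rpow_mul (hd.weightFlow_nonneg hp x), Real.conjExponent]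
  congr 1
  field_simp

theorem eqFun_mul_weightFlow (hp : 1 < p) (x : List ℕ) :
    eqFun p d x * weightFlow p d x = eqFun p d x ^ p := by
  have h1 : (p - 1)⁻¹ * p = (p - 1)⁻¹ + 1 := by
    have : p - 1 ≠ 0 := by linarith
    field_simp; ring
  rw [← hd.weightFlow_rpow hp, ← Real.rpow_mul (hd.weightFlow_nonneg hp x), h1,
    Real.rpow_add_one' (hd.weightFlow_nonneg hp x)]
  have : 0 < (p - 1)⁻¹ := inv_pos.2 (by linarith)
  linarith

theorem eqFun_eq_zero (hp : 1 < p) (x : List ℕ) (hx : x ∉ T.carrier) : eqFun p d x = 0 := by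
  have : (p - 1)⁻¹ ≠ 0 := inv_ne_zero (by linarith)
  rw [eqFun, hd.eq_zero x hx, Real.zero_rpow this, mul_zero]

/-- The recursion of a weight, multiplied by the survival to the power p - 1, is conservation of the
flow. -/
theorem isFlow (hp : 1 < p) : T.IsFlow (weightFlow p d) where
  nonneg := hd.weightFlow_nonneg hp
  eq_zero x hx := by rw [weightFlow, hd.eq_zero x hx, mul_zero]
  hasSum x hx hl := by
    have := (hd.hasSum x hx hl).mul_left (survival p d x ^ (p - 1))
    refine this.congr_fun fun a => ?_
    rw [weightFlow, survival_concat, Real.mul_rpow (hd.survival_nonneg hp x)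
      (hd.drop_nonneg hp x), mul_assoc]

theorem pathSum_ofReal_eqFun (hp : 1 < p) (x : List ℕ) :
    pathSum (fun y => ENNReal.ofReal (eqFun p d y)) x =
      ENNReal.ofReal (1 - survival p d x * drop p d x) := by
  rw [← pathSum_eqFun, pathSum, pathSum,
    ENNReal.ofReal_sum_of_nonneg fun k _ => hd.eqFun_nonneg hp _]

theorem tsum_eqFun_le_one (hp : 1 < p) (ζ : T.Boundary) :
    ∑' x : ζ.1, ENNReal.ofReal (eqFun p d x) ≤ 1 := by
  refine ζ.isMaximalPath.tsum_le (fun y => ENNReal.ofReal (eqFun p d y)) fun x _ => ?_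
  rw [hd.pathSum_ofReal_eqFun hp, ← ENNReal.ofReal_one]
  refine ENNReal.ofReal_le_ofReal (sub_le_self _ ?_)
  exact mul_nonneg (hd.survival_nonneg hp x) (hd.drop_nonneg hp x)

/-- The drop vanishes where the weight is 1, so the path sum there is 1. The path may belong to
another tree `S`: weights of a truncated tree are tested on boundary points of the whole tree. -/
theorem one_le_tsum_eqFun_of_eq_one (hp : 1 < p) {S : LocallyFiniteTree}
    (h : S.IsMaximalPath P) {x : List ℕ} (hx : x ∈ P)
    (hx1 : d x = 1) : 1 ≤ ∑' y : P, ENNReal.ofReal (eqFun p d y) := by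
  refine le_trans ?_ (h.pathSum_le_tsum (fun y => ENNReal.ofReal (eqFun p d y)) hx)
  rw [hd.pathSum_ofReal_eqFun hp]
  simp [drop, hx1]

theorem one_le_tsum_eqFun_of_tendsto (hp : 1 < p) (h : T.IsMaximalPath P) {s : ℕ → List ℕ}
    (hs : ∀ n, s n ∈ P)
    (ht : Filter.Tendsto (fun n => survival p d (s n)) Filter.atTop (nhds 0)) :
    1 ≤ ∑' y : P, ENNReal.ofReal (eqFun p d y) := by
  have h1 : Filter.Tendsto (fun n => ENNReal.ofReal (1 - survival p d (s n))) Filter.atTop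
      (nhds 1) := by
    have := ENNReal.tendsto_ofReal (ht.const_sub 1)
    simpa using this
  refine le_of_tendsto' h1 fun n => ?_
  refine le_trans ?_ (h.pathSum_le_tsum (fun y => ENNReal.ofReal (eqFun p d y)) (hs n))
  rw [hd.pathSum_ofReal_eqFun hp]
  refine ENNReal.ofReal_le_ofReal (sub_le_sub_left ?_ 1)
  exact mul_le_of_le_one_right (hd.survival_nonneg hp _) (hd.drop_le_one _)

/-! ### Duality -/

omit hd in
theorem weightFlow_nil : weightFlow p d [] = d [] := by simp [weightFlow, survival_nil]

theorem lintegral_eqFun (hp : 1 < p) {μ : Measure T.Boundary}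
    (hμ : ∀ x, μ (T.tent x) = ENNReal.ofReal (weightFlow p d x)) :
    ∫⁻ ζ, ∑' x : ζ.1, ENNReal.ofReal (eqFun p d x) ∂μ =
      ∑' x, ENNReal.ofReal (eqFun p d x) ^ p := by
  rw [lintegral_tsum_eq hμ fun x => ENNReal.ofReal (eqFun p d x)]
  refine tsum_congr fun x => ?_
  rw [← ENNReal.ofReal_mul (hd.eqFun_nonneg hp x), hd.eqFun_mul_weightFlow hp,
    ENNReal.ofReal_rpow_of_nonneg (hd.eqFun_nonneg hp x) (by linarith)]

omit hd in
theorem measure_univ {μ : Measure T.Boundary}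
    (hμ : ∀ x, μ (T.tent x) = ENNReal.ofReal (weightFlow p d x)) :
    μ Set.univ = ENNReal.ofReal (d []) := by
  rw [← tent_nil, hμ, weightFlow_nil]

/-- By Tonelli the energy is ∫ If dμ, and If ≤ 1. -/
theorem energy_le (hp : 1 < p) :
    ∑' x, ENNReal.ofReal (eqFun p d x) ^ p ≤ ENNReal.ofReal (d []) := by
  obtain ⟨μ, hμ⟩ := (hd.isFlow hp).exists_measure
  rw [← hd.lintegral_eqFun hp hμ, ← measure_univ hμ, ← lintegral_one]
  exact lintegral_mono fun ζ => hd.tsum_eqFun_le_one hp ζ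

/-- Integrating Ig ≥ 1 over `A` bounds μ(A) by ∑ g·M; Young's inequality and M^p' = f^p do the rest.
-/
theorem measure_le (hp : 1 < p) {μ : Measure T.Boundary}
    (hμ : ∀ x, μ (T.tent x) = ENNReal.ofReal (weightFlow p d x)) (g : List ℕ → ℝ≥0∞)
    {A : Set T.Boundary} (hg : ∀ ζ ∈ A, 1 ≤ ∑' x : ζ.1, g x) :
    μ A ≤ (∑' x, g x ^ p) / ENNReal.ofReal p +
      (∑' x, ENNReal.ofReal (eqFun p d x) ^ p) / ENNReal.ofReal p.conjExponent := by
  calc μ A = ∫⁻ ζ in A, 1 ∂μ := by simp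
    _ ≤ ∫⁻ ζ in A, ∑' x : ζ.1, g x ∂μ := setLIntegral_mono (measurable_tsum g) hg
    _ ≤ ∫⁻ ζ, ∑' x : ζ.1, g x ∂μ := setLIntegral_le_lintegral _ _
    _ = ∑' x, g x * ENNReal.ofReal (weightFlow p d x) := lintegral_tsum_eq hμ g
    _ ≤ ∑' x, (g x ^ p / ENNReal.ofReal p +
          ENNReal.ofReal (eqFun p d x) ^ p / ENNReal.ofReal p.conjExponent) := by
        refine ENNReal.tsum_le_tsum fun x => ?_
        have hpq := Real.HolderConjugate.conjExponent hp
        refine (ENNReal.young_inequality _ _ hpq).trans_eq ?_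
        rw [ENNReal.ofReal_rpow_of_nonneg (hd.weightFlow_nonneg hp x) hpq.symm.nonneg,
          ← hd.eqFun_rpow hp, ENNReal.ofReal_rpow_of_nonneg (hd.eqFun_nonneg hp x) hpq.nonneg]
    _ = _ := by
        rw [ENNReal.tsum_add]
        simp_rw [div_eq_mul_inv, ENNReal.tsum_mul_right]

omit hd in
theorem _root_.ENNReal.div_add_div_conjExponent (hp : 1 < p) (c : ℝ≥0∞) :
    c / ENNReal.ofReal p + c / ENNReal.ofReal p.conjExponent = c := by
  have hpq := Real.HolderConjugate.conjExponent hp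
  rw [div_eq_mul_inv, div_eq_mul_inv, ← mul_add, hpq.inv_add_inv_ennreal, mul_one]

/-- The lower bound of energies by the mass of a flow. -/
theorem le_of_forall_mem (hp : 1 < p) {μ : Measure T.Boundary}
    (hμ : ∀ x, μ (T.tent x) = ENNReal.ofReal (weightFlow p d x)) (g : List ℕ → ℝ≥0∞)
    {A : Set T.Boundary} (hA : MeasurableSet A) (hg : ∀ ζ ∈ A, 1 ≤ ∑' x : ζ.1, g x) {e : ℝ≥0∞}
    (he : μ Aᶜ ≤ e / ENNReal.ofReal p) : ENNReal.ofReal (d []) ≤ ∑' x, g x ^ p + e := by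
  have hpq := Real.HolderConjugate.conjExponent hp
  have h1 := hd.measure_le hp hμ g hg
  have h2 := hd.energy_le hp
  have h3 : ENNReal.ofReal (d []) = μ A + μ Aᶜ := by
    rw [measure_add_measure_compl hA, measure_univ hμ]
  set c := ENNReal.ofReal (d []) with hc
  -- Writing c = c/p + c/p' lets the finite term c/p' cancel, and multiplying by p turns the loss
  -- e/p into e.
  have h4 : c / ENNReal.ofReal p + c / ENNReal.ofReal p.conjExponent ≤
      (∑' x, g x ^ p + e) / ENNReal.ofReal p + c / ENNReal.ofReal p.conjExponent := by
    rw [ENNReal.div_add_div_conjExponent hp, ENNReal.add_div]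
    calc c ≤ (∑' x, g x ^ p) / ENNReal.ofReal p + c / ENNReal.ofReal p.conjExponent +
          e / ENNReal.ofReal p := by
          rw [h3]; refine add_le_add (h1.trans ?_) he
          rw [← h3]; gcongr
      _ = _ := by ring
  have h5 := (ENNReal.add_le_add_iff_right (ENNReal.div_ne_top ENNReal.ofReal_ne_top
    (by simpa using hpq.symm.pos))).1 h4
  exact (ENNReal.mul_le_mul_iff_left (by simp) (by simpa using hpq.pos)).1 h5

theorem le_capacity (hp : 1 < p) : ENNReal.ofReal (d []) ≤ T.boundaryCapacity p := by
  obtain ⟨μ, hμ⟩ := (hd.isFlow hp).exists_measure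
  refine le_iInf₂ fun f hf => ?_
  rw [normPow_eq_tsum_extend (by linarith)]
  simpa using hd.le_of_forall_mem hp hμ (fun x => T.extend f x) MeasurableSet.univ (e := 0)
    (fun ζ _ => by rw [← potential_eq_tsum_extend]; exact hf.2 ζ trivial) (by simp)

/-- A weight whose candidate for the equilibrium function has no irregular points yields the
capacity, and the boundary is regular. -/
theorem hasRegularBoundary (hp : 1 < p)
    (hreg : ∀ ζ : T.Boundary, 1 ≤ ∑' x : ζ.1, ENNReal.ofReal (eqFun p d x)) :
    T.HasRegularBoundary p ∧ T.boundaryCapacity p = ENNReal.ofReal (d []) := by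
  obtain ⟨μ, hμ⟩ := (hd.isFlow hp).exists_measure
  have hconj : p.conjExponent - 1 = (p - 1)⁻¹ := by
    have : p - 1 ≠ 0 := by linarith
    rw [Real.conjExponent]; field_simp; ring
  have hfun : T.copotentialPow p μ = fun α => (eqFun p d α.1).toNNReal := by
    funext α
    have : μ (T.tentBoundary α) = ENNReal.ofReal (weightFlow p d α.1) := hμ α.1
    rw [copotentialPow, this, ENNReal.ofReal, ENNReal.toNNReal_coe, hconj, ← hd.weightFlow_rpow hp,
      Real.toNNReal_rpow_of_nonneg (hd.weightFlow_nonneg hp _)]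
  have hpot : ∀ ζ, 1 ≤ T.potential (T.copotentialPow p μ) ζ := by
    intro ζ
    rw [hfun, potential_eq_tsum fun x => (eqFun p d x).toNNReal]
    exact hreg ζ
  have hnorm : T.normPow p (T.copotentialPow p μ) ≤ ENNReal.ofReal (d []) := by
    rw [hfun, normPow_eq_tsum (by linarith) (fun x => (eqFun p d x).toNNReal)
      fun x hx => by simp [hd.eqFun_eq_zero hp x hx]]
    exact hd.energy_le hp
  -- The candidate is itself a test function, so it approximates itself in the closure.
  have htest : T.copotentialPow p μ ∈ T.testFunctions p Set.univ :=
    ⟨hnorm.trans_lt ENNReal.ofReal_lt_top, fun ζ _ => hpot ζ⟩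
  have hcap : T.capacity p Set.univ = ENNReal.ofReal (d []) :=
    le_antisymm ((iInf₂_le _ htest).trans hnorm) (hd.le_capacity hp)
  refine ⟨⟨μ, ⟨⟨?_⟩, by simp, ⟨fun δ hδ => ⟨_, htest, ?_⟩, ?_⟩, ?_⟩, ?_⟩, hcap⟩
  · rw [measure_univ hμ]; exact ENNReal.ofReal_lt_top
  · have : 0 < p := by linarith
    simpa [this] using hδ
  · exact le_antisymm (hnorm.trans_eq hcap.symm) (iInf₂_le _ htest)
  · rw [closure_univ, measure_univ hμ, hcap]
  · exact Set.eq_empty_of_forall_notMem fun ζ hζ => (hpot ζ).not_gt hζ.2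

end IsWeight

end LocallyFiniteTree

namespace LocallyFiniteTree

variable {T : LocallyFiniteTree} {p : ℝ}

/-! ### The weight given by the capacities of the tents -/

open Classical in
variable (T) in
/-- The letters `a` for which `x ++ [a]` is an edge of `T`. -/
noncomputable def children (x : List ℕ) : Finset ℕ :=
  if h : x ∈ T.carrier then (T.finite_children x h).toFinset else ∅

theorem mem_children {x : List ℕ} {a : ℕ} : a ∈ T.children x ↔ x ++ [a] ∈ T.carrier := by
  by_cases h : x ∈ T.carrier
  · simp [children, h]
  · simpa [children, h] using fun h' => h (T.mem_of_concat_mem h')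

/-- The capacity of an edge followed by tents of total capacity `C`. -/
noncomputable def seriesCapacity (p C : ℝ) : ℝ :=
  (C ^ (p - 1)⁻¹ / (1 + C ^ (p - 1)⁻¹)) ^ (p - 1)

theorem seriesCapacity_nonneg {C : ℝ} (hC : 0 ≤ C) : 0 ≤ seriesCapacity p C := by
  have := Real.rpow_nonneg hC (p - 1)⁻¹
  exact Real.rpow_nonneg (by positivity) _

theorem seriesCapacity_le_one (hp : 1 < p) {C : ℝ} (hC : 0 ≤ C) : seriesCapacity p C ≤ 1 := by
  have := Real.rpow_nonneg hC (p - 1)⁻¹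
  refine Real.rpow_le_one (by positivity) ?_ (by linarith)
  rw [div_le_one (by positivity)]
  linarith

theorem seriesCapacity_mono (hp : 1 < p) {C D : ℝ} (hC : 0 ≤ C) (h : C ≤ D) :
    seriesCapacity p C ≤ seriesCapacity p D := by
  have h0 := Real.rpow_nonneg hC (p - 1)⁻¹
  have h1 : C ^ (p - 1)⁻¹ ≤ D ^ (p - 1)⁻¹ := Real.rpow_le_rpow hC h (by simp; linarith)
  refine Real.rpow_le_rpow (by positivity) ?_ (by linarith)
  rw [div_le_div_iff₀ (by positivity) (by linarith)]
  nlinarith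

theorem tendsto_seriesCapacity (hp : 1 < p) {u : ℕ → ℝ} {C : ℝ} (hC : 0 ≤ C)
    (hu : Filter.Tendsto u Filter.atTop (nhds C)) :
    Filter.Tendsto (fun n => seriesCapacity p (u n)) Filter.atTop (nhds (seriesCapacity p C)) := by
  have h0 := Real.rpow_nonneg hC (p - 1)⁻¹
  have hq : 0 ≤ (p - 1)⁻¹ := by simp; linarith
  have h1 := hu.rpow_const (p := (p - 1)⁻¹) (Or.inr hq)
  exact (h1.div (h1.const_add 1) (by positivity)).rpow_const (Or.inr (by linarith))

/-- Turns the series law into the recursion of weights: the drop across the edge is 1 / (1 +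
C^(1/(p-1))). -/
theorem one_sub_seriesCapacity_rpow_mul (hp : 1 < p) {C : ℝ} (hC : 0 ≤ C) :
    (1 - seriesCapacity p C ^ (p - 1)⁻¹) ^ (p - 1) * C = seriesCapacity p C := by
  have h0 := Real.rpow_nonneg hC (p - 1)⁻¹
  have hp' : p - 1 ≠ 0 := by linarith
  have h1 : 1 - seriesCapacity p C ^ (p - 1)⁻¹ = (1 + C ^ (p - 1)⁻¹)⁻¹ := by
    rw [seriesCapacity, Real.rpow_rpow_inv (by positivity) hp']
    field_simp
    ring
  have h2 : C = (C ^ (p - 1)⁻¹) ^ (p - 1) := (Real.rpow_inv_rpow hC hp').symm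
  rw [h1, Real.inv_rpow (by positivity), seriesCapacity, Real.div_rpow h0 (by positivity), ← h2]
  exact inv_mul_eq_div _ _

theorem hasSum_of_eq_seriesCapacity (hp : 1 < p) {d : List ℕ → ℝ} (h0 : ∀ x, 0 ≤ d x)
    (hT : ∀ x ∉ T.carrier, d x = 0) {x : List ℕ}
    (hx : d x = seriesCapacity p (∑ a ∈ T.children x, d (x ++ [a]))) :
    HasSum (fun a => drop p d x ^ (p - 1) * d (x ++ [a])) (d x) := by
  have h1 := one_sub_seriesCapacity_rpow_mul hp
    (Finset.sum_nonneg fun a (_ : a ∈ T.children x) => h0 (x ++ [a]))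
  rw [← hx] at h1
  have h2 : HasSum (fun a => d (x ++ [a])) (∑ a ∈ T.children x, d (x ++ [a])) :=
    hasSum_sum_of_ne_finset_zero fun a ha => hT _ (by rwa [mem_children] at ha)
  exact h1 ▸ h2.mul_left _

open Classical in
variable (T) in
/-- The capacities of the tents of `T` cut off `n` levels above their root edges. -/
noncomputable def approxCapacity (p : ℝ) : ℕ → List ℕ → ℝ
  | 0, x => if x ∈ T.carrier then 1 else 0
  | n + 1, x => if x ∈ T.carrier then
      if T.IsLeaf x then 1 else seriesCapacity p (∑ a ∈ T.children x, approxCapacity p n (x ++ [a]))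
    else 0

theorem approxCapacity_of_notMem {x : List ℕ} (hx : x ∉ T.carrier) (n : ℕ) :
    T.approxCapacity p n x = 0 := by
  cases n <;> simp [approxCapacity, hx]

theorem approxCapacity_of_isLeaf {x : List ℕ} (hx : T.IsLeaf x) (n : ℕ) :
    T.approxCapacity p n x = 1 := by
  cases n <;> simp [approxCapacity, hx, hx.1]

theorem approxCapacity_succ {x : List ℕ} (hx : x ∈ T.carrier) (hl : ¬ T.IsLeaf x) (n : ℕ) :
    T.approxCapacity p (n + 1) x =
      seriesCapacity p (∑ a ∈ T.children x, T.approxCapacity p n (x ++ [a])) := by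
  simp [approxCapacity, hx, hl]

theorem approxCapacity_nonneg (n : ℕ) (x : List ℕ) : 0 ≤ T.approxCapacity p n x := by
  induction n generalizing x with
  | zero => rw [approxCapacity]; split_ifs <;> simp
  | succ n ih =>
    rw [approxCapacity]
    split_ifs
    · simp
    · exact seriesCapacity_nonneg (Finset.sum_nonneg fun _ _ => ih _)
    · simp

theorem approxCapacity_le_one (hp : 1 < p) (n : ℕ) (x : List ℕ) : T.approxCapacity p n x ≤ 1 := by
  cases n with
  | zero => rw [approxCapacity]; split_ifs <;> simp
  | succ n =>
    rw [approxCapacity]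
    split_ifs
    · simp
    · exact seriesCapacity_le_one hp (Finset.sum_nonneg fun _ _ => approxCapacity_nonneg _ _)
    · simp

/-- One more level replaces the value 1 at the cut by a value at most 1, and the series law is
monotone. -/
theorem approxCapacity_antitone (hp : 1 < p) (x : List ℕ) :
    Antitone fun n => T.approxCapacity p n x := by
  refine antitone_nat_of_succ_le fun n => ?_
  by_cases hx : x ∈ T.carrier
  swap
  · simp [approxCapacity_of_notMem hx]
  by_cases hl : T.IsLeaf x
  · simp [approxCapacity_of_isLeaf hl]
  induction n generalizing x with
  | zero =>
    refine (approxCapacity_le_one hp _ _).trans_eq ?_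
    simp [approxCapacity, hx]
  | succ n ih =>
    rw [approxCapacity_succ hx hl, approxCapacity_succ hx hl]
    refine seriesCapacity_mono hp (Finset.sum_nonneg fun _ _ => approxCapacity_nonneg _ _)
      (Finset.sum_le_sum fun a ha => ?_)
    by_cases hla : T.IsLeaf (x ++ [a])
    · simp [approxCapacity_of_isLeaf hla]
    · exact ih _ (mem_children.1 ha) hla

variable (T) in
/-- The capacity of the boundary of the tent rooted at `x`. -/
noncomputable def tentCapacity (p : ℝ) (x : List ℕ) : ℝ := ⨅ n, T.approxCapacity p n x

theorem tendsto_approxCapacity (hp : 1 < p) (x : List ℕ) :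
    Filter.Tendsto (fun n => T.approxCapacity p n x) Filter.atTop (nhds (T.tentCapacity p x)) :=
  tendsto_atTop_ciInf (approxCapacity_antitone hp x)
    ⟨0, by rintro _ ⟨n, rfl⟩; exact approxCapacity_nonneg n x⟩

/-- The recursion passes to the limit because local finiteness keeps its sums finite. -/
theorem isWeight_tentCapacity (hp : 1 < p) : T.IsWeight p (T.tentCapacity p) where
  nonneg x := ge_of_tendsto' (tendsto_approxCapacity hp x) fun n => approxCapacity_nonneg n x
  le_one x := le_of_tendsto' (tendsto_approxCapacity hp x) fun n => approxCapacity_le_one hp n x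
  eq_zero x hx := by simp [tentCapacity, approxCapacity_of_notMem hx]
  eq_one x hx := by simp [tentCapacity, approxCapacity_of_isLeaf hx]
  hasSum x hx hl := by
    have h0 : ∀ x, 0 ≤ T.tentCapacity p x := fun x =>
      ge_of_tendsto' (tendsto_approxCapacity hp x) fun n => approxCapacity_nonneg n x
    refine hasSum_of_eq_seriesCapacity (T := T) hp h0
      (fun y hy => by simp [tentCapacity, approxCapacity_of_notMem hy]) ?_
    have h1 := (tendsto_approxCapacity (T := T) hp x).comp (Filter.tendsto_add_atTop_nat 1)
    refine tendsto_nhds_unique (h1.congr fun n => approxCapacity_succ hx hl n) ?_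
    exact tendsto_seriesCapacity hp (Finset.sum_nonneg fun a _ => h0 _)
      (tendsto_finsetSum _ fun a _ => tendsto_approxCapacity hp _)

/-! ### Truncated trees and the formula for the capacity -/

variable (T) in
/-- The subtree of the edges of `T` of level at most `N`. -/
def truncate (N : ℕ) : LocallyFiniteTree where
  carrier := ⟨{x | x ∈ T.carrier ∧ x.length ≤ N}, fun x a h =>
    ⟨T.mem_of_concat_mem h.1, by have := h.2; simp at this; omega⟩⟩
  root_mem := ⟨T.root_mem, by simp⟩
  finite_children x hx := (T.finite_children x hx.1).subset fun _ ha => ha.1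

theorem mem_truncate {N : ℕ} {x : List ℕ} :
    x ∈ (T.truncate N).carrier ↔ x ∈ T.carrier ∧ x.length ≤ N := Iff.rfl

variable (T) in
/-- The capacities of the tents of the truncated tree. -/
noncomputable def truncateCapacity (p : ℝ) (N : ℕ) (x : List ℕ) : ℝ :=
  if x.length ≤ N then T.approxCapacity p (N - x.length) x else 0

theorem truncateCapacity_of_length_eq {N : ℕ} {x : List ℕ} (hx : x ∈ T.carrier)
    (h : x.length = N) : T.truncateCapacity p N x = 1 := by
  simp [truncateCapacity, h, approxCapacity, hx]

theorem truncateCapacity_of_isLeaf {N : ℕ} {x : List ℕ} (hx : T.IsLeaf x)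
    (h : x.length ≤ N) : T.truncateCapacity p N x = 1 := by
  simp [truncateCapacity, h, approxCapacity_of_isLeaf hx]

theorem isWeight_truncateCapacity (hp : 1 < p) (N : ℕ) :
    (T.truncate N).IsWeight p (T.truncateCapacity p N) := by
  have h0 : ∀ x, 0 ≤ T.truncateCapacity p N x := fun x => by
    rw [truncateCapacity]; split_ifs
    exacts [approxCapacity_nonneg _ _, le_rfl]
  have hz : ∀ x ∉ (T.truncate N).carrier, T.truncateCapacity p N x = 0 := fun x hx => by
    rw [truncateCapacity]; split_ifs with h
    exacts [approxCapacity_of_notMem (fun hx' => hx ⟨hx', h⟩) _, rfl]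
  refine ⟨h0, fun x => ?_, hz, fun x hx => ?_, fun x hx hl => ?_⟩
  · rw [truncateCapacity]; split_ifs
    exacts [approxCapacity_le_one hp _ _, zero_le_one]
  · rcases hx.1.2.eq_or_lt with h | h
    · exact truncateCapacity_of_length_eq hx.1.1 h
    · refine truncateCapacity_of_isLeaf ⟨hx.1.1, fun a ha => hx.2 a ⟨ha, ?_⟩⟩ hx.1.2
      simpa using h
  · refine hasSum_of_eq_seriesCapacity hp h0 hz ?_
    have hlt : x.length < N := by
      refine hx.2.lt_of_ne fun h => hl ⟨hx, fun a ha => ?_⟩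
      have := ha.2
      simp at this; omega
    obtain ⟨k, hk⟩ : ∃ k, N - x.length = k + 1 := ⟨N - x.length - 1, by omega⟩
    have hlT : ¬ T.IsLeaf x := fun h => hl ⟨hx, fun a ha => h.2 a ha.1⟩
    have hch : (T.truncate N).children x = T.children x := by
      ext a
      rw [mem_children, mem_children, mem_truncate]
      simp; omega
    rw [truncateCapacity, if_pos hx.2, hk, approxCapacity_succ hx.1 hlT, hch]
    congr 1
    refine Finset.sum_congr rfl fun a _ => ?_
    rw [truncateCapacity, if_pos (by simp; omega)]
    congr 1
    simp; omega

theorem one_le_tsum_eqFun_truncateCapacity (hp : 1 < p) (N : ℕ) (ζ : T.Boundary) :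
    1 ≤ ∑' x : ζ.1, ENNReal.ofReal (eqFun p (T.truncateCapacity p N) x) := by
  obtain ⟨x, hx, h⟩ := ζ.isMaximalPath.exists_length_eq_or_isLeaf N
  refine (isWeight_truncateCapacity hp N).one_le_tsum_eqFun_of_eq_one hp ζ.isMaximalPath hx ?_
  rcases h with h | ⟨h, hl⟩
  · exact truncateCapacity_of_length_eq (ζ.isMaximalPath.subset x hx) h
  · exact truncateCapacity_of_isLeaf hl h

theorem tsum_eqFun_truncateCapacity_le (hp : 1 < p) (N : ℕ) :
    ∑' x, ENNReal.ofReal (eqFun p (T.truncateCapacity p N) x) ^ p ≤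
      ENNReal.ofReal (T.approxCapacity p N []) := by
  simpa [truncateCapacity] using (isWeight_truncateCapacity (T := T) hp N).energy_le hp

/-- Duality gives the lower bound. The equilibrium functions of the truncated trees are test
functions on all of ∂T, and the bounds on their energies decrease to the limit. -/
theorem boundaryCapacity_eq (hp : 1 < p) :
    T.boundaryCapacity p = ENNReal.ofReal (T.tentCapacity p []) := by
  refine le_antisymm ?_ ((isWeight_tentCapacity hp).le_capacity hp)
  refine ge_of_tendsto' (ENNReal.tendsto_ofReal (tendsto_approxCapacity hp [])) fun N => ?_
  have hn : T.normPow p (fun α => (eqFun p (T.truncateCapacity p N) α.1).toNNReal) ≤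
      ENNReal.ofReal (T.approxCapacity p N []) := by
    rw [normPow_eq_tsum (by linarith) (fun x => (eqFun p (T.truncateCapacity p N) x).toNNReal)]
    · exact tsum_eqFun_truncateCapacity_le hp N
    · intro x hx
      simp [(isWeight_truncateCapacity hp N).eqFun_eq_zero hp x fun h => hx h.1]
  refine (iInf₂_le _ ⟨hn.trans_lt ENNReal.ofReal_lt_top, fun ζ _ => ?_⟩).trans hn
  rw [potential_eq_tsum fun x => (eqFun p (T.truncateCapacity p N) x).toNNReal]
  exact one_le_tsum_eqFun_truncateCapacity hp N ζ

/-- With regularity not assumed, μ is tested on the functions of the truncated trees: c ≤ c_N/p +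
E/p'. In the limit c/p cancels, leaving c ≤ E. -/
theorem le_energy_tentCapacity (hp : 1 < p) :
    ENNReal.ofReal (T.tentCapacity p []) ≤
      ∑' x, ENNReal.ofReal (eqFun p (T.tentCapacity p) x) ^ p := by
  have hpq := Real.HolderConjugate.conjExponent hp
  obtain ⟨μ, hμ⟩ := ((isWeight_tentCapacity (T := T) hp).isFlow hp).exists_measure
  set c := ENNReal.ofReal (T.tentCapacity p []) with hc
  set E := ∑' x, ENNReal.ofReal (eqFun p (T.tentCapacity p) x) ^ p with hE
  have h1 : ∀ N, c ≤ ENNReal.ofReal (T.approxCapacity p N []) / ENNReal.ofReal p +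
      E / ENNReal.ofReal p.conjExponent := by
    intro N
    rw [hc, ← IsWeight.measure_univ hμ]
    refine ((isWeight_tentCapacity hp).measure_le hp hμ
      (fun x => ENNReal.ofReal (eqFun p (T.truncateCapacity p N) x))
      fun ζ _ => one_le_tsum_eqFun_truncateCapacity hp N ζ).trans ?_
    gcongr
    exact tsum_eqFun_truncateCapacity_le hp N
  have h2 : c ≤ c / ENNReal.ofReal p + E / ENNReal.ofReal p.conjExponent := by
    refine ge_of_tendsto' (x := Filter.atTop) (Filter.Tendsto.add_const _ ?_) h1
    exact ENNReal.Tendsto.div_const (ENNReal.tendsto_ofReal (tendsto_approxCapacity hp []))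
      (Or.inr (by simpa using hpq.pos))
  have h3 := (ENNReal.div_add_div_conjExponent hp c).trans_le h2
  have h4 := (ENNReal.add_le_add_iff_left (ENNReal.div_ne_top ENNReal.ofReal_ne_top
    (by simpa using hpq.pos))).1 h3
  exact (ENNReal.mul_le_mul_iff_left (by simp) (by simpa using hpq.symm.pos)).1 h4

/-- Irregular points, and the tents of capacity zero, are negligible for the equilibrium measure. -/
theorem ae_one_le_tsum_eqFun (hp : 1 < p) {μ : Measure T.Boundary}
    (hμ : ∀ x, μ (T.tent x) = ENNReal.ofReal (weightFlow p (T.tentCapacity p) x)) :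
    ∀ᵐ ζ ∂μ, 1 ≤ (∑' x : ζ.1, ENNReal.ofReal (eqFun p (T.tentCapacity p) x)) ∧
      ∀ x ∈ ζ.1, 0 < T.tentCapacity p x := by
  have hw := isWeight_tentCapacity (T := T) hp
  refine Filter.Eventually.and ?_ ?_
  · have hint := hw.lintegral_eqFun hp hμ
    -- A potential at most 1 whose integral is the full mass equals 1 almost everywhere.
    have h := ae_eq_of_ae_le_of_lintegral_le (μ := μ) (g := fun _ => 1)
      (.of_forall (hw.tsum_eqFun_le_one hp)) ?_ aemeasurable_const ?_
    · filter_upwards [h] with ζ hζ using hζ.ge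
    · rw [hint]; exact ((hw.energy_le hp).trans_lt ENNReal.ofReal_lt_top).ne
    · rw [hint, lintegral_one, IsWeight.measure_univ hμ]
      exact le_energy_tentCapacity hp
  · rw [ae_all_iff]
    intro x
    by_cases hx : 0 < T.tentCapacity p x
    · exact .of_forall fun _ _ => hx
    · have h0 : T.tentCapacity p x = 0 := le_antisymm (not_lt.1 hx) (hw.nonneg x)
      have h1 : μ (T.tent x) = 0 := by rw [hμ, weightFlow, h0]; simp
      filter_upwards [measure_eq_zero_iff_ae_notMem.1 h1] with ζ hζ hxζ using absurd hxζ hζ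

end LocallyFiniteTree

namespace LocallyFiniteTree

variable {T : LocallyFiniteTree} {p : ℝ} {cut : List ℕ → Prop}

/-! ### Replacing tents by caterpillars of the same capacity -/

/-- The total capacity of the tents following an edge whose tent has capacity `t < 1`. -/
noncomputable def childrenCapacity (p t : ℝ) : ℝ := t / (1 - t ^ (p - 1)⁻¹) ^ (p - 1)

open Classical in
/-- The capacities of the tents that follow an edge of capacity `t` of a caterpillar: as many leaves
as possible, and one more tent for the remainder. -/
noncomputable def caterpillarChild (p t : ℝ) (a : ℕ) : ℝ :=
  -- Capacity 1 means a leaf; `childrenCapacity` would divide by zero there.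
  if t = 1 then 0 else max 0 (min 1 (childrenCapacity p t - a))

theorem caterpillarChild_nonneg (t : ℝ) (a : ℕ) : 0 ≤ caterpillarChild p t a := by
  rw [caterpillarChild]; split_ifs <;> simp

theorem caterpillarChild_le_one (t : ℝ) (a : ℕ) : caterpillarChild p t a ≤ 1 := by
  rw [caterpillarChild]; split_ifs <;> simp

theorem caterpillarChild_zero (a : ℕ) : caterpillarChild p 0 a = 0 := by
  simp [caterpillarChild, childrenCapacity]

theorem one_sub_rpow_pos (hp : 1 < p) {t : ℝ} (h0 : 0 ≤ t) (h1 : t < 1) :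
    0 < 1 - t ^ (p - 1)⁻¹ :=
  sub_pos.2 (Real.rpow_lt_one h0 h1 (inv_pos.2 (by linarith)))

theorem childrenCapacity_pos (hp : 1 < p) {t : ℝ} (h0 : 0 < t) (h1 : t < 1) :
    0 < childrenCapacity p t :=
  div_pos h0 (Real.rpow_pos_of_pos (one_sub_rpow_pos hp h0.le h1) _)

/-- The sum of the first n terms is min(n, C). -/
theorem hasSum_max_min_sub {C : ℝ} (hC : 0 ≤ C) :
    HasSum (fun a : ℕ => max 0 (min 1 (C - a))) C := by
  rw [hasSum_iff_tendsto_nat_of_nonneg fun a => le_max_left _ _]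
  have h : ∀ n : ℕ, ∑ a ∈ Finset.range n, max 0 (min 1 (C - a)) = min (n : ℝ) C := by
    intro n
    induction n with
    | zero => simp [hC]
    | succ n ih =>
      rw [Finset.sum_range_succ, ih]
      push_cast
      rcases le_total C n with h1 | h1
      · rw [min_eq_right h1, min_eq_right (by linarith : C ≤ n + 1),
          min_eq_right (by linarith : C - n ≤ 1), max_eq_left (by linarith), add_zero]
      · rw [min_eq_left h1, max_eq_right (le_min zero_le_one (by linarith)), ← min_add_add_left,
          add_sub_cancel]
  simp_rw [h]
  obtain ⟨N, hN⟩ := exists_nat_ge C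
  refine tendsto_const_nhds.congr' ?_
  filter_upwards [Filter.eventually_ge_atTop N] with n hn
  exact (min_eq_right (hN.trans (by exact_mod_cast hn))).symm

theorem hasSum_caterpillarChild (hp : 1 < p) {t : ℝ} (h0 : 0 ≤ t) (h1 : t < 1) :
    HasSum (fun a => (1 - t ^ (p - 1)⁻¹) ^ (p - 1) * caterpillarChild p t a) t := by
  have h2 := Real.rpow_pos_of_pos (one_sub_rpow_pos hp h0 h1) (p - 1)
  have h3 := (hasSum_max_min_sub (div_nonneg h0 h2.le)).mul_left
    ((1 - t ^ (p - 1)⁻¹) ^ (p - 1))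
  rw [mul_div_cancel₀ _ h2.ne'] at h3
  simp only [caterpillarChild, if_neg h1.ne]
  exact h3

theorem finite_caterpillarChild_pos (t : ℝ) : {a : ℕ | 0 < caterpillarChild p t a}.Finite := by
  obtain ⟨N, hN⟩ := exists_nat_ge (childrenCapacity p t)
  refine (Set.finite_lt_nat N).subset fun a ha => ?_
  by_contra h
  have h1 : (N : ℝ) ≤ a := by exact_mod_cast not_lt.1 h
  refine (Set.mem_ofPred.1 ha).ne' ?_
  rw [caterpillarChild]
  split_ifs
  · rfl
  · exact max_eq_left ((min_le_right _ _).trans (by linarith))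

/-- A small tent of a caterpillar is followed by a single tent, with a greater capacity. -/
theorem caterpillarChild_rpow (hp : 1 < p) {t : ℝ} (h0 : 0 < t) (ht : t ^ (p - 1)⁻¹ < 1 / 2) {a : ℕ}
    (ha : 0 < caterpillarChild p t a) :
    (caterpillarChild p t a ^ (p - 1)⁻¹)⁻¹ = (t ^ (p - 1)⁻¹)⁻¹ - 1 := by
  have hp' : p - 1 ≠ 0 := by linarith
  set u := t ^ (p - 1)⁻¹ with hu
  have hu0 : 0 < u := Real.rpow_pos_of_pos h0 _
  have htu : t = u ^ (p - 1) := (Real.rpow_inv_rpow h0.le hp').symm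
  -- As u < 1/2 this is at most 1, so only the letter 0 has positive capacity; the reciprocal of
  -- u/(1-u) is 1/u - 1.
  have hψ : childrenCapacity p t = (u / (1 - u)) ^ (p - 1) := by
    rw [Real.div_rpow hu0.le (by linarith), ← htu, childrenCapacity]
  have hψ1 : childrenCapacity p t ≤ 1 := by
    rw [hψ]
    refine Real.rpow_le_one (div_nonneg hu0.le (by linarith)) ?_ (by linarith)
    rw [div_le_one (by linarith)]
    linarith
  have ht1 : t ≠ 1 := by rintro rfl; norm_num [hu] at ht
  rw [caterpillarChild, if_neg ht1] at ha ⊢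
  have ha0 : a = 0 := by
    by_contra h
    have : (1 : ℝ) ≤ a := by exact_mod_cast Nat.one_le_iff_ne_zero.2 h
    refine ha.ne' (max_eq_left ((min_le_right _ _).trans (by linarith)))
  have hpos : 0 ≤ u / (1 - u) := div_nonneg hu0.le (by linarith)
  have hψ0 : 0 ≤ childrenCapacity p t := hψ ▸ Real.rpow_nonneg hpos _
  rw [ha0, Nat.cast_zero, sub_zero, min_eq_right hψ1, max_eq_right hψ0, hψ,
    Real.rpow_rpow_inv hpos hp', inv_div, sub_div, div_self hu0.ne', one_div]

open Classical in
variable (T) in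
/-- The capacities of the tents of the tree obtained from `T` by replacing the tents rooted at the
words where `cut` holds by caterpillars. -/
noncomputable def regraftCapacity (p : ℝ) (cut : List ℕ → Prop) (x : List ℕ) : ℝ :=
  List.reverseRecOn x (T.tentCapacity p []) fun y a r =>
    if cut y then caterpillarChild p r a else T.tentCapacity p (y ++ [a])

theorem regraftCapacity_nil : T.regraftCapacity p cut [] = T.tentCapacity p [] := by
  simp [regraftCapacity]

theorem regraftCapacity_concat_of_cut {x : List ℕ} (hx : cut x) (a : ℕ) :
    T.regraftCapacity p cut (x ++ [a]) = caterpillarChild p (T.regraftCapacity p cut x) a := by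
  simp [regraftCapacity, hx]

theorem regraftCapacity_concat_of_not_cut {x : List ℕ} (hx : ¬ cut x) (a : ℕ) :
    T.regraftCapacity p cut (x ++ [a]) = T.tentCapacity p (x ++ [a]) := by
  simp [regraftCapacity, hx]

section Regraft

variable (hcut : ∀ x a, cut x → cut (x ++ [a]))

include hcut in
theorem regraftCapacity_of_not_cut {x : List ℕ} (hx : ¬ cut x) :
    T.regraftCapacity p cut x = T.tentCapacity p x := by
  induction x using List.reverseRecOn with
  | nil => exact regraftCapacity_nil
  | append_singleton x a ih => exact regraftCapacity_concat_of_not_cut (fun h => hx (hcut x a h)) a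

theorem regraftCapacity_mem_Icc (hp : 1 < p) (x : List ℕ) :
    T.regraftCapacity p cut x ∈ Set.Icc (0 : ℝ) 1 := by
  have hw := isWeight_tentCapacity (T := T) hp
  cases x using List.reverseRecOn with
  | nil => rw [regraftCapacity_nil]; exact ⟨hw.nonneg _, hw.le_one _⟩
  | append_singleton x a =>
    by_cases h : cut x
    · rw [regraftCapacity_concat_of_cut h]
      exact ⟨caterpillarChild_nonneg _ _, caterpillarChild_le_one _ _⟩
    · rw [regraftCapacity_concat_of_not_cut h]
      exact ⟨hw.nonneg _, hw.le_one _⟩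

theorem mem_of_tentCapacity_pos (hp : 1 < p) {x : List ℕ} (hx : 0 < T.tentCapacity p x) :
    x ∈ T.carrier := by
  by_contra h
  exact hx.ne' ((isWeight_tentCapacity hp).eq_zero x h)

/-- If the capacity at `x` vanishes, the drop is 1 and the capacities after `x` sum to zero. -/
theorem tentCapacity_pos_of_concat (hp : 1 < p) {x : List ℕ} {a : ℕ}
    (h : 0 < T.tentCapacity p (x ++ [a])) : 0 < T.tentCapacity p x := by
  have hw := isWeight_tentCapacity (T := T) hp
  have hxa := mem_of_tentCapacity_pos hp h
  have hq : (p - 1)⁻¹ ≠ 0 := inv_ne_zero (by linarith)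
  refine (hw.nonneg x).lt_of_ne fun h0 => ?_
  have hs := hw.hasSum x (T.mem_of_concat_mem hxa) fun hl => hl.2 a hxa
  rw [drop, ← h0, Real.zero_rpow hq] at hs
  simp only [sub_zero, Real.one_rpow, one_mul] at hs
  have := le_hasSum hs a fun b _ => hw.nonneg _
  linarith

theorem regraftCapacity_pos_of_concat (hp : 1 < p) {x : List ℕ} {a : ℕ}
    (hcut : ∀ x a, cut x → cut (x ++ [a]))
    (h : 0 < T.regraftCapacity p cut (x ++ [a])) : 0 < T.regraftCapacity p cut x := by
  by_cases hx : cut x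
  · refine (regraftCapacity_mem_Icc hp x).1.lt_of_ne fun h0 => ?_
    rw [regraftCapacity_concat_of_cut hx, ← h0, caterpillarChild_zero] at h
    exact h.false
  · rw [regraftCapacity_concat_of_not_cut hx] at h
    rw [regraftCapacity_of_not_cut hcut hx]
    exact tentCapacity_pos_of_concat hp h

/-- The tree obtained from `T` by erasing the edges whose tents have capacity zero, and by replacing
the tents rooted at the words where `cut` holds by caterpillars of the same capacity. -/
noncomputable def regraft (T : LocallyFiniteTree) (hp : 1 < p) (hT : 0 < T.tentCapacity p [])
    (hcut : ∀ x a, cut x → cut (x ++ [a])) : LocallyFiniteTree where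
  carrier := ⟨{x | 0 < T.regraftCapacity p cut x},
    fun _ _ h => regraftCapacity_pos_of_concat hp hcut h⟩
  root_mem := by
    change 0 < T.regraftCapacity p cut []
    rwa [regraftCapacity_nil]
  finite_children x hx := by
    by_cases h : cut x
    · refine (finite_caterpillarChild_pos (p := p) (T.regraftCapacity p cut x)).subset fun a ha => ?_
      rw [Set.mem_ofPred, ← regraftCapacity_concat_of_cut h]
      exact ha
    · have hx' : 0 < T.regraftCapacity p cut x := hx
      rw [regraftCapacity_of_not_cut hcut h] at hx'
      refine (T.finite_children x (mem_of_tentCapacity_pos hp hx')).subset fun a ha => ?_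
      refine mem_of_tentCapacity_pos hp ?_
      rw [← regraftCapacity_concat_of_not_cut h]
      exact ha

variable (hp : 1 < p) (hT : 0 < T.tentCapacity p [])

theorem mem_regraft {x : List ℕ} :
    x ∈ (T.regraft hp hT hcut).carrier ↔ 0 < T.regraftCapacity p cut x := Iff.rfl

/-- Erased edges contribute zero to the recursion. No new leaf has capacity below 1: in a
caterpillar such an edge is followed by the letter 0, and elsewhere a non-leaf of `T` with only null
tents after it is null itself. -/
theorem isWeight_regraft : (T.regraft hp hT hcut).IsWeight p (T.regraftCapacity p cut) := by
  have hw := isWeight_tentCapacity (T := T) hp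
  have h0 : ∀ x ∉ (T.regraft hp hT hcut).carrier, T.regraftCapacity p cut x = 0 := fun x hx =>
    le_antisymm (not_lt.1 hx) (regraftCapacity_mem_Icc hp x).1
  refine ⟨fun x => (regraftCapacity_mem_Icc hp x).1, fun x => (regraftCapacity_mem_Icc hp x).2,
    h0, fun x hx => ?_, fun x hx hl => ?_⟩
  · by_cases h : cut x
    · refine (regraftCapacity_mem_Icc hp x).2.eq_or_lt.resolve_right fun h1 => hx.2 0 ?_
      rw [mem_regraft, regraftCapacity_concat_of_cut h, caterpillarChild, if_neg h1.ne]
      refine lt_max_of_lt_right (lt_min one_pos ?_)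
      simpa using childrenCapacity_pos hp hx.1 h1
    · have hx0 := (mem_regraft hcut hp hT).1 hx.1
      rw [regraftCapacity_of_not_cut hcut h] at hx0 ⊢
      by_cases hl : T.IsLeaf x
      · exact hw.eq_one x hl
      · have hs := hw.hasSum x (mem_of_tentCapacity_pos hp hx0) hl
        have hz : ∀ a, T.tentCapacity p (x ++ [a]) = 0 := fun a => by
          rw [← regraftCapacity_concat_of_not_cut h]
          exact h0 _ (hx.2 a)
        simp only [hz, mul_zero] at hs
        exact absurd (hs.unique hasSum_zero) hx0.ne'
  · by_cases h : cut x
    · simp_rw [regraftCapacity_concat_of_cut h]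
      refine hasSum_caterpillarChild hp hx.le ?_
      refine (regraftCapacity_mem_Icc hp x).2.lt_of_ne fun h1 => hl ⟨hx, fun a ha => ?_⟩
      rw [mem_regraft, regraftCapacity_concat_of_cut h, caterpillarChild, if_pos h1] at ha
      exact ha.false
    · have hx0 := (mem_regraft hcut hp hT).1 hx
      simp_rw [regraftCapacity_concat_of_not_cut h, drop, regraftCapacity_of_not_cut hcut h]
      rw [regraftCapacity_of_not_cut hcut h] at hx0
      refine hw.hasSum x (mem_of_tentCapacity_pos hp hx0) fun hl' => hl ⟨hx, fun a ha => ?_⟩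
      rw [mem_regraft, regraftCapacity_concat_of_not_cut h] at ha
      exact hl'.2 a (mem_of_tentCapacity_pos hp ha)

include hcut hp hT in
-- In a caterpillar, while d^(1/(p-1)) stays below 1/2, its reciprocal falls by 1 at each edge. It
-- must stay positive, so values at least 1/2 recur, and each of them at least halves the survival.
theorem tendsto_survival_of_cut {s : ℕ → List ℕ} (hs : ∀ n, ∃ a : ℕ, s (n + 1) = s n ++ [a])
    (hpos : ∀ n, 0 < T.regraftCapacity p cut (s n)) {n : ℕ} (hn : cut (s n)) :
    Filter.Tendsto (fun k => survival p (T.regraftCapacity p cut) (s k)) Filter.atTop (nhds 0) := by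
  have hw := isWeight_regraft hcut hp hT
  have hdc : ∀ x a, cut x → T.regraftCapacity p cut (x ++ [a]) =
      caterpillarChild p (T.regraftCapacity p cut x) a := fun _ a hx =>
    regraftCapacity_concat_of_cut hx a
  set d := T.regraftCapacity p cut
  set V := fun k => survival p d (s k) with hV
  have hVs : ∀ k, V (k + 1) = V k * drop p d (s k) := fun k => by
    obtain ⟨a, ha⟩ := hs k
    rw [hV]; simp only [ha]; exact survival_concat _ _
  have hV0 : ∀ k, 0 ≤ V k := fun k => hw.survival_nonneg hp _
  have hanti : Antitone V := antitone_nat_of_succ_le fun k => by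
    rw [hVs]; exact mul_le_of_le_one_right (hV0 k) (hw.drop_le_one _)
  have hcuts : ∀ k, n ≤ k → cut (s k) := fun k hk => by
    induction k, hk using Nat.le_induction with
    | base => exact hn
    | succ k _ ih => obtain ⟨a, ha⟩ := hs k; rw [ha]; exact hcut _ _ ih
  have hfreq : ∀ k, n ≤ k → ∃ j, k ≤ j ∧ 1 / 2 ≤ d (s j) ^ (p - 1)⁻¹ := by
    intro k hk
    by_contra! hlt
    have hstep : ∀ i, (d (s (k + i)) ^ (p - 1)⁻¹)⁻¹ = (d (s k) ^ (p - 1)⁻¹)⁻¹ - i := by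
      intro i
      induction i with
      | zero => simp
      | succ i ih =>
        obtain ⟨a, ha⟩ := hs (k + i)
        have hc := hcuts (k + i) (by omega)
        have hpos' := hpos (k + i + 1)
        rw [ha, hdc _ _ hc] at hpos'
        rw [← add_assoc, ha, hdc _ _ hc,
          caterpillarChild_rpow hp (hpos _) (hlt _ (by omega)) hpos', ih]
        push_cast; ring
    obtain ⟨i, hi⟩ := exists_nat_gt (d (s k) ^ (p - 1)⁻¹)⁻¹
    have h1 := hstep i
    have h2 := inv_pos.2 (Real.rpow_pos_of_pos (hpos (k + i)) (p - 1)⁻¹)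
    linarith
  have hlim := tendsto_atTop_ciInf hanti ⟨0, by rintro _ ⟨k, rfl⟩; exact hV0 k⟩
  set L := ⨅ k, V k
  have hL0 : 0 ≤ L := ge_of_tendsto' hlim hV0
  have hL : L ≤ L / 2 := by
    refine le_of_tendsto_of_tendsto_of_frequently (hlim.comp (Filter.tendsto_add_atTop_nat 1))
      (hlim.div_const 2) (Filter.frequently_atTop.2 fun k => ?_)
    obtain ⟨j, hj, hj2⟩ := hfreq (max k n) (le_max_right _ _)
    refine ⟨j, (le_max_left _ _).trans hj, ?_⟩
    simp only [Function.comp_apply, hVs, drop]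
    nlinarith [hV0 j]
  have : L = 0 := by linarith
  rwa [this] at hlim

/-- A leaf has weight 1, a ray entering a caterpillar loses all survival, and any other ray is a ray
of `T` with unchanged weights. -/
theorem hasRegularBoundary_regraft
    (hreg : ∀ ζ : T.Boundary, (∀ x ∈ ζ.1, ¬ cut x) →
      1 ≤ ∑' x : ζ.1, ENNReal.ofReal (eqFun p (T.tentCapacity p) x)) :
    (T.regraft hp hT hcut).HasRegularBoundary p ∧
      (T.regraft hp hT hcut).boundaryCapacity p = T.boundaryCapacity p := by
  have hw := isWeight_regraft hcut hp hT
  rw [boundaryCapacity_eq (T := T) hp, ← regraftCapacity_nil (T := T) (cut := cut)]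
  refine hw.hasRegularBoundary hp fun ζ => ?_
  rcases ζ.2 with ⟨s, h0, hs, hR, hζ⟩ | ⟨x, hx, hζ⟩
  · by_cases hc : ∃ n, cut (s n)
    · obtain ⟨n, hn⟩ := hc
      exact hw.one_le_tsum_eqFun_of_tendsto hp ζ.isMaximalPath (s := s)
        (fun k => hζ ▸ Set.mem_range_self k) (tendsto_survival_of_cut hcut hp hT hs hR hn)
    · push Not at hc
      have hmem : ∀ x ∈ ζ.1, ¬ cut x := by
        rw [hζ]; rintro _ ⟨n, rfl⟩; exact hc n
      have heq : ∀ x ∈ ζ.1, T.regraftCapacity p cut x = T.tentCapacity p x := fun x hx =>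
        regraftCapacity_of_not_cut hcut (hmem x hx)
      have hTs : ∀ n, s n ∈ T.carrier := fun n => by
        have h1 := (mem_regraft hcut hp hT).1 (hR n)
        rw [regraftCapacity_of_not_cut hcut (hc n)] at h1
        exact mem_of_tentCapacity_pos hp h1
      refine (hreg ⟨ζ.1, Or.inl ⟨s, h0, hs, hTs, hζ⟩⟩ hmem).trans_eq (tsum_congr fun x => ?_)
      have hV : survival p (T.tentCapacity p) x.1 = survival p (T.regraftCapacity p cut) x.1 :=
        Finset.prod_congr rfl fun k _ => by
          rw [drop, drop, heq _ (ζ.isMaximalPath.prefix_mem _ _ x.2 (List.take_prefix _ _))]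
      rw [eqFun, eqFun, hV, heq _ x.2]
  · refine hw.one_le_tsum_eqFun_of_eq_one hp ζ.isMaximalPath (x := x) ?_ (hw.eq_one x hx)
    rw [hζ]
    exact List.prefix_rfl

end Regraft

/-! ### The approximating tree -/

theorem IsMaximalPath.of_isLeaf {S : LocallyFiniteTree} {P : Set (List ℕ)} (h : T.IsMaximalPath P)
    (hsub : ∀ x ∈ P, x ∈ S.carrier) (hleaf : ∀ x ∈ P, T.IsLeaf x → S.IsLeaf x) :
    S.IsMaximalPath P :=
  ⟨h.nil_mem, hsub, h.prefix_mem, h.chain,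
    fun x hx hl => h.exists_concat x hx fun hl' => hl (hleaf x hx hl')⟩

theorem exists_hasRegularBoundary (hp : 1 < p) (hT : 0 < T.boundaryCapacity p) {ε : ℝ}
    (hε : 0 < ε) : ∃ R : LocallyFiniteTree, R.HasRegularBoundary p ∧
      R.boundaryCapacity p = T.boundaryCapacity p ∧
      T.boundaryCapacity p - ENNReal.ofReal ε ≤
        (T.commonSubtree R).capacity p (T.commonBoundary R) := by
  have hw := isWeight_tentCapacity (T := T) hp
  have hT' : 0 < T.tentCapacity p [] := by simpa [boundaryCapacity_eq hp] using hT
  obtain ⟨μ, hμ⟩ := (hw.isFlow hp).exists_measure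
  have : IsFiniteMeasure μ := ⟨by rw [IsWeight.measure_univ hμ]; exact ENNReal.ofReal_lt_top⟩
  have hε' : 0 < ENNReal.ofReal ε / ENNReal.ofReal p :=
    ENNReal.div_pos (by simpa using hε) ENNReal.ofReal_ne_top
  -- The bound ε/p offsets the factor p lost in `le_of_forall_mem`.
  obtain ⟨U, hAU, hU, hμU⟩ := exists_isOpen_superset_measure_lt μ
    ((ae_iff.1 (ae_one_le_tsum_eqFun hp hμ)).trans_lt hε')
  have hgood : ∀ ζ ∉ U, 1 ≤ (∑' x : ζ.1, ENNReal.ofReal (eqFun p (T.tentCapacity p) x)) ∧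
      ∀ x ∈ ζ.1, 0 < T.tentCapacity p x := fun ζ hζ => by
    by_contra h
    exact hζ (hAU h)
  -- Words outside `T` have empty tents and hence are cut. As `U` is open, a boundary point with no
  -- cut edge lies outside `U`.
  let cut : List ℕ → Prop := fun x => T.tent x ⊆ U
  have hcut : ∀ x a, cut x → cut (x ++ [a]) := fun x a hx ζ hζ =>
    hx (ζ.isMaximalPath.prefix_mem _ _ hζ (List.prefix_append x [a]))
  have hreg := hasRegularBoundary_regraft hcut hp hT' fun ζ hζ => by
    refine (hgood ζ fun hζU => ?_).1
    obtain ⟨x, hx, hxU⟩ := exists_tent_subset hU hζU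
    exact hζ x hx hxU
  refine ⟨T.regraft hp hT' hcut, hreg.1, hreg.2, ?_⟩
  set R := T.regraft hp hT' hcut
  have hmemR : ∀ ζ ∉ U, ∀ x ∈ ζ.1, x ∈ R.carrier := fun ζ hζ x hx => by
    rw [mem_regraft, regraftCapacity_of_not_cut hcut fun h => hζ (h hx)]
    exact (hgood ζ hζ).2 x hx
  have hR : ∀ ζ ∉ U, R.IsBoundaryPoint ζ.1 := fun ζ hζ => by
    refine isBoundaryPoint_iff.2 (ζ.isMaximalPath.of_isLeaf (hmemR ζ hζ) fun x hx hl =>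
      ⟨hmemR ζ hζ x hx, fun a ha => hl.2 a ?_⟩)
    rw [mem_regraft, regraftCapacity_concat_of_not_cut fun h => hζ (h hx)] at ha
    exact mem_of_tentCapacity_pos hp ha
  have hTR : ∀ ζ ∉ U, (T.commonSubtree R).IsBoundaryPoint ζ.1 := fun ζ hζ =>
    isBoundaryPoint_iff.2 (ζ.isMaximalPath.of_isLeaf
      (fun x hx => ⟨ζ.isMaximalPath.subset x hx, hmemR ζ hζ x hx⟩)
      fun x hx hl => ⟨⟨hl.1, hmemR ζ hζ x hx⟩, fun a ha => hl.2 a ha.1⟩)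
  refine le_iInf₂ fun g hg => ?_
  rw [tsub_le_iff_right, boundaryCapacity_eq hp, normPow_eq_tsum_extend (by linarith)]
  -- The test function of the common subtree, extended by zero, is tested in `T` on the complement
  -- of `U`.
  refine hw.le_of_forall_mem hp hμ _ hU.measurableSet.compl (fun ζ hζ => ?_)
    (by rw [compl_compl]; exact hμU.le)
  exact (hg.2 ⟨ζ.1, hTR ζ hζ⟩ ⟨ζ.2, hR ζ hζ⟩).trans_eq (potential_eq_tsum_extend _ _)

theorem capacity_mono {A B : Set T.Boundary} (h : A ⊆ B) : T.capacity p A ≤ T.capacity p B :=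
  iInf_le_iInf_of_subset fun _ hf => ⟨hf.1, fun ζ hζ => hf.2 ζ (h hζ)⟩

end LocallyFiniteTree

theorem mainTheorem4 (p : ℝ) (hp : 1 < p) (T : LocallyFiniteTree) (hT : 0 < T.boundaryCapacity p) :
    (∃ R : LocallyFiniteTree, R.HasRegularBoundary p ∧
      R.boundaryCapacity p = T.boundaryCapacity p) ∧
    ∀ ε : ℝ, 0 < ε → ∃ R : LocallyFiniteTree, R.HasRegularBoundary p ∧
      R.boundaryCapacity p = T.boundaryCapacity p ∧
      T.boundaryCapacity p - ENNReal.ofReal ε ≤ (T.commonSubtree R).boundaryCapacity p ∧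
      T.boundaryCapacity p - ENNReal.ofReal ε ≤
        (T.commonSubtree R).capacity p (T.commonBoundary R) := by
  constructor
  · obtain ⟨R, h1, h2, -⟩ := LocallyFiniteTree.exists_hasRegularBoundary hp hT one_pos
    exact ⟨R, h1, h2⟩
  · intro ε hε
    obtain ⟨R, h1, h2, h3⟩ := LocallyFiniteTree.exists_hasRegularBoundary hp hT hε
    exact ⟨R, h1, h2, h3.trans (LocallyFiniteTree.capacity_mono (Set.subset_univ _)), h3⟩
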